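/- Let $d\ge 2$, $p\ge 1$, let $\mathcal C_d\subset\{0,1\}^{d\times d}$ be the set of the $d$ cyclic shift matrices $U$, $(Uv)_i=v_{i+t\ (\mathrm{mod}\ d)}$ for some integer $t$, and let $\theta^*\in\mathbb R^d$ and $Z^*=(Z_1^*,\dots,Z_p^*)\in\mathcal C_d^p$. Observe independent $Y_j\sim\mathcal N(Z_j^*\theta^*,I_d)$, $j=1,\dots,p$. Put $$\Delta_{\min}^2=\min_{U\in\mathcal C_d,\,U\ne I_d}\|(I_d-U)\theta^*\|^2,\qquad \ell(Z,Z^*)=\sum_{j=1}^p\|(Z_j-Z_j^*)\theta^*\|^2,\qquad \widehat\theta(Z)=\frac1p\sum_{j=1}^pZ_j^TY_j .$$ Starting from an arbitrary, possibly data-dependent, $Z^{(0)}\in\mathcal C_d^p$, iterate for $t\ge 1$ $$Z_j^{(t)}\in\mathop{\rm argmin}_{U\in\mathcal C_d}\|Y_j-U\widehat\theta(Z^{(t-1)})\|^2,\qquad j=1,\dots,p .$$ Consider a sequence of such problems, indexed by $n$, with $p=p_n$, $d=d_n$, $\theta^*=\theta^*_n$ and $\Delta_{\min}=\Delta_{\min,n}$,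 such that $$\frac{\Delta_{\min}^2}{\log d+d/p}\to\infty ,$$ and let $\tau_n=o(p\Delta_{\min}^2)$. Then there is a sequence $\delta_n\to0$ such that, for every $n$, every $Z^*\in\mathcal C_d^p$, every $\eta\ge0$ and every initialization with $\ell(Z^{(0)},Z^*)\le\tau_n$ with probability at least $1-\eta$, $$\ell(Z^{(t)},Z^*)\le p\exp\left(-(1+\delta_n)\frac{\Delta_{\min}^2}{8}\right)+\frac12\,\ell(Z^{(t-1)},Z^*)\qquad\text{for all }t\ge1$$ holds with probability at least $1-\eta-\exp(-\Delta_{\min})-e^{-d}$. -/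

import Mathlib

open MeasureTheory ProbabilityTheory Filter Topology
open scoped Matrix

namespace MRA

noncomputable section

/-- The `d × d` zero-one matrix of the cyclic shift by `t`, with indices `0, …, d - 1`:
`(U v)_i = v_{(i + t) mod d}`. -/
def cyclicShift (d t : ℕ) : Matrix (Fin d) (Fin d) ℝ :=
  Matrix.of fun i k => if (k : ℕ) = ((i : ℕ) + t) % d then 1 else 0

/-- The class `𝒞_d` of cyclic shifts, as a set of `d × d` matrices. -/
def cyclicShifts (d : ℕ) : Set (Matrix (Fin d) (Fin d) ℝ) :=
  Set.range (cyclicShift d)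

/-- `Δ_min² = min_{U ∈ 𝒞_d, U ≠ I_d} ‖(I_d - U) θ‖²`. -/
def minGapSq {d : ℕ} (θ : EuclideanSpace ℝ (Fin d)) : ℝ :=
  sInf ((fun U : Matrix (Fin d) (Fin d) ℝ => ‖(1 - U).toEuclideanLin θ‖ ^ 2) ''
    (cyclicShifts d \ {1}))

/-- The loss `ℓ(Z, Z*) = ∑_j ‖(Z_j - Z*_j) θ*‖²`. -/
def loss {p d : ℕ} (θ : EuclideanSpace ℝ (Fin d))
    (Z Zstar : Fin p → Matrix (Fin d) (Fin d) ℝ) : ℝ :=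
  ∑ j, ‖(Z j - Zstar j).toEuclideanLin θ‖ ^ 2

/-- The least-squares estimator `θ̂(Z) = p⁻¹ ∑_j Z_jᵀ Y_j`. -/
def thetaHat {p d : ℕ} (y : Fin p → EuclideanSpace ℝ (Fin d))
    (Z : Fin p → Matrix (Fin d) (Fin d) ℝ) : EuclideanSpace ℝ (Fin d) :=
  (p : ℝ)⁻¹ • ∑ j, (Z j)ᵀ.toEuclideanLin (y j)

/-- `Z'` is a result of one iteration started from `Z` on the data `y`:
`Z'_j ∈ argmin_{U ∈ 𝒞_d} ‖y_j - U θ̂(Z)‖²` for every `j` (ties may be broken arbitrarily). -/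
def IsUpdate {p d : ℕ} (y : Fin p → EuclideanSpace ℝ (Fin d))
    (Z Z' : Fin p → Matrix (Fin d) (Fin d) ℝ) : Prop :=
  ∀ j, Z' j ∈ cyclicShifts d ∧
    ∀ U ∈ cyclicShifts d,
      ‖y j - (Z' j).toEuclideanLin (thetaHat y Z)‖ ^ 2 ≤
        ‖y j - U.toEuclideanLin (thetaHat y Z)‖ ^ 2

/-- The multireference alignment model: the `Y_j` are independent and `Y_j ∼ N(Z*_j θ*, I_d)`. -/
structure IsModel {Ω : Type*} [MeasurableSpace Ω] (μ : Measure Ω) {p d : ℕ}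
    (θ : EuclideanSpace ℝ (Fin d)) (Zstar : Fin p → Matrix (Fin d) (Fin d) ℝ)
    (Y : Fin p → Ω → EuclideanSpace ℝ (Fin d)) : Prop where
  law : ∀ j, HasLaw (Y j) (multivariateGaussian ((Zstar j).toEuclideanLin θ) 1) μ
  indep : iIndepFun Y μ

end

end MRA

/-! Undoing the true shifts turns the data into `θ + x j` with i.i.d. standard Gaussian `x j`, and
the iterates into tuples of group elements to be compared with the identity. The estimator becomes
`θ`, plus the mean noise, plus an alignment error `e` whose squared norm is at most a small multiple
of loss`/p` (`groupEstimate_eq`, `norm_alignment_error_sq_le`).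

If `g` is preferred to the identity at observation `j`, expanding one inner product leaves two
possibilities (`gap_le_indicator_add`). Either `x j` exceeds nearly half the gap in the direction
obtained from `θ` and the leave-one-out mean, an event that does not involve the current alignment;
or `⟪x j, T g e - e⟫` exceeds a small multiple of the gap. The first kind sums to at most `excess`.
The second is controlled by an operator norm bound on the noise, uniform over alignments, and costs
at most half the previous loss (`groupLoss_le_excess_add_half`). Because of this uniformity, one
good noise event serves every iteration and every data-dependent initialization.

The uniform bound fails with exponentially small probability: the supremum over shifts and
directions costs about `p log d + d`, which is small against `p Δ_min²`
(`noiseLaw_not_noiseBound_le`). Given the leave-one-out mean, the first kind of event has a Gaussian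
tail close to `exp (-gap / 8)`, and Markov's inequality bounds `excess` (`noiseLaw_misalignSet_le`,
`noiseLaw_excess_gt_le`). This gives the recursion for each fixed loss `ε` in the exponent;
`exists_tendsto_zero_of_eventually` then lets `ε` tend to zero along the sequence. -/

namespace MRA

noncomputable section

open scoped RealInnerProductSpace

/-! ### One iteration as a deterministic inequality for a group of isometries -/

section Deterministic

variable {E G : Type*} [NormedAddCommGroup E] [InnerProductSpace ℝ E] [Group G] {p : ℕ}

/-- The squared displacement of `θ` under the group element `g`. -/
def gap (T : G →* (E ≃ₗᵢ[ℝ] E)) (θ : E) (g : G) : ℝ := ‖T g θ - θ‖ ^ 2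

/-- The loss of a tuple of group elements relative to the identity. -/
def groupLoss (T : G →* (E ≃ₗᵢ[ℝ] E)) (θ : E) (w : Fin p → G) : ℝ := ∑ j, gap T θ (w j)

/-- The least-squares estimator from the observations `θ + x j` and the alignments `w j`. -/
def groupEstimate (T : G →* (E ≃ₗᵢ[ℝ] E)) (θ : E) (x : Fin p → E) (w : Fin p → G) : E :=
  (p : ℝ)⁻¹ • ∑ j, T (w j)⁻¹ (θ + x j)

/-- The sum of the noise vectors other than the `j`-th, divided by `p`. -/
def looMean (x : Fin p → E) (j : Fin p) : E := (p : ℝ)⁻¹ • ∑ i ∈ Finset.univ.erase j, x i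

/-- The noise configurations for which `g` beats the identity at the `j`-th observation up to a
factor `c`, the centre being perturbed by a leave-one-out mean of norm at most `r`. -/
def misalignSet (T : G →* (E ≃ₗᵢ[ℝ] E)) (θ : E) (r c : ℝ) (j : Fin p) (g : G) :
    Set (Fin p → E) :=
  {x | ‖looMean x j‖ ≤ r ∧
    c * gap T θ g ≤ ⟪x j, T g (θ + looMean x j) - (θ + looMean x j)⟫}

/-- The total gap over the misalignment events. -/
def excess [Fintype G] (T : G →* (E ≃ₗᵢ[ℝ] E)) (θ : E) (r c : ℝ) (x : Fin p → E) : ℝ :=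
  ∑ j, ∑ g, (misalignSet T θ r c j g).indicator (fun _ => gap T θ g) x

/-- The noise has operator norm at most `√L`, uniformly over all alignments. -/
def NoiseBound (T : G →* (E ≃ₗᵢ[ℝ] E)) (L : ℝ) (x : Fin p → E) : Prop :=
  ∀ (u : Fin p → G) (a : E), ∑ j, ⟪x j, T (u j) a⟫ ^ 2 ≤ L * ‖a‖ ^ 2

lemma gap_nonneg (T : G →* (E ≃ₗᵢ[ℝ] E)) (θ : E) (g : G) : 0 ≤ gap T θ g := sq_nonneg _

lemma gap_one (T : G →* (E ≃ₗᵢ[ℝ] E)) (θ : E) : gap T θ 1 = 0 := by simp [gap]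

lemma groupLoss_nonneg (T : G →* (E ≃ₗᵢ[ℝ] E)) (θ : E) (w : Fin p → G) :
    0 ≤ groupLoss T θ w := Finset.sum_nonneg fun _ _ => gap_nonneg _ _ _

lemma map_inv_map (T : G →* (E ≃ₗᵢ[ℝ] E)) (g : G) (x : E) : T g⁻¹ (T g x) = x := by
  change (T g⁻¹ * T g) x = x
  rw [← map_mul]; simp

lemma map_map_inv (T : G →* (E ≃ₗᵢ[ℝ] E)) (g : G) (x : E) : T g (T g⁻¹ x) = x := by
  change (T g * T g⁻¹) x = x
  rw [← map_mul]; simp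

lemma inner_map_inv (T : G →* (E ≃ₗᵢ[ℝ] E)) (g : G) (x y : E) :
    ⟪T g⁻¹ x, y⟫ = ⟪x, T g y⟫ := by
  rw [← (T g).inner_map_map, map_map_inv]

lemma norm_map_inv_sub_sq (T : G →* (E ≃ₗᵢ[ℝ] E)) (θ : E) (g : G) :
    ‖T g⁻¹ θ - θ‖ ^ 2 = gap T θ g := by
  rw [gap, ← (T g).norm_map (T g⁻¹ θ - θ), map_sub, map_map_inv, norm_sub_rev]

/-- By this sign, the contribution of `x j` to the mean noise can be dropped, so that only the
leave-one-out mean, independent of `x j`, remains. -/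
lemma inner_map_sub_self_nonpos (f : E ≃ₗᵢ[ℝ] E) (x : E) : ⟪x, f x - x⟫ ≤ 0 := by
  have := real_inner_le_norm x (f x)
  rw [f.norm_map] at this
  rw [inner_sub_right, real_inner_self_eq_norm_mul_norm]
  linarith

/-- Duality: test the hypothesis against the sum itself and apply Cauchy–Schwarz over `S`. The
factor `S.card` instead of `p` is what later brings in the loss. -/
lemma norm_sum_sq_le_of_sum_inner_sq_le {η : Fin p → E} {L : ℝ} (hL : 0 ≤ L)
    (h : ∀ a, ∑ j, ⟪η j, a⟫ ^ 2 ≤ L * ‖a‖ ^ 2) (S : Finset (Fin p)) :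
    ‖∑ j ∈ S, η j‖ ^ 2 ≤ S.card * L := by
  set y := ∑ j ∈ S, η j with hy
  rcases eq_or_ne y 0 with h0 | h0
  · rw [h0, norm_zero, zero_pow two_ne_zero]
    positivity
  have hpos : 0 < ‖y‖ ^ 2 := by positivity
  have h1 : ‖y‖ ^ 2 = ∑ j ∈ S, ⟪η j, y⟫ := by
    rw [← sum_inner, ← hy, real_inner_self_eq_norm_sq]
  have h2 : (‖y‖ ^ 2) ^ 2 ≤ S.card * ∑ j ∈ S, ⟪η j, y⟫ ^ 2 := by
    rw [h1]; exact sq_sum_le_card_mul_sum_sq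
  have h3 : ∑ j ∈ S, ⟪η j, y⟫ ^ 2 ≤ L * ‖y‖ ^ 2 :=
    (Finset.sum_le_sum_of_subset_of_nonneg (Finset.subset_univ S)
      fun _ _ _ => sq_nonneg _).trans (h y)
  have h4 : ‖y‖ ^ 2 * ‖y‖ ^ 2 ≤ (S.card * L) * ‖y‖ ^ 2 := by
    nlinarith [mul_le_mul_of_nonneg_left h3 (Nat.cast_nonneg (α := ℝ) S.card)]
  exact le_of_mul_le_mul_right h4 hpos

lemma NoiseBound.sum_inner_sq_le {T : G →* (E ≃ₗᵢ[ℝ] E)} {L : ℝ} {x : Fin p → E}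
    (hx : NoiseBound T L x) (a : E) : ∑ j, ⟪x j, a⟫ ^ 2 ≤ L * ‖a‖ ^ 2 := by
  simpa using hx (fun _ => 1) a

lemma NoiseBound.sum_inner_sub_sq_le {T : G →* (E ≃ₗᵢ[ℝ] E)} {L : ℝ} {x : Fin p → E}
    (hx : NoiseBound T L x) (u : Fin p → G) (a : E) :
    ∑ j, ⟪x j, T (u j) a - a⟫ ^ 2 ≤ 4 * L * ‖a‖ ^ 2 := by
  have h : ∀ j, ⟪x j, T (u j) a - a⟫ ^ 2 ≤ 2 * ⟪x j, T (u j) a⟫ ^ 2 + 2 * ⟪x j, a⟫ ^ 2 := by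
    intro j
    rw [inner_sub_right]
    nlinarith [sq_nonneg (⟪x j, T (u j) a⟫ + ⟪x j, a⟫)]
  calc _ ≤ ∑ j, (2 * ⟪x j, T (u j) a⟫ ^ 2 + 2 * ⟪x j, a⟫ ^ 2) := Finset.sum_le_sum fun j _ => h j
    _ = 2 * ∑ j, ⟪x j, T (u j) a⟫ ^ 2 + 2 * ∑ j, ⟪x j, a⟫ ^ 2 := by
      rw [Finset.sum_add_distrib, Finset.mul_sum, Finset.mul_sum]
    _ ≤ _ := by linarith [hx u a, hx.sum_inner_sq_le a]

lemma NoiseBound.norm_mean_sq_le {T : G →* (E ≃ₗᵢ[ℝ] E)} {l m : ℝ} {x : Fin p → E}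
    (hp : 1 ≤ p) (hlm : 0 ≤ l * m) (hx : NoiseBound T (l * p * m) x) (S : Finset (Fin p)) :
    ‖(p : ℝ)⁻¹ • ∑ j ∈ S, x j‖ ^ 2 ≤ l * m := by
  have hp' : (0 : ℝ) < p := by exact_mod_cast hp
  have hL : l * p * m = p * (l * m) := by ring
  have h := norm_sum_sq_le_of_sum_inner_sq_le (by rw [hL]; positivity) hx.sum_inner_sq_le S
  have hS : (S.card : ℝ) ≤ p := by
    exact_mod_cast (Finset.card_le_univ S).trans_eq (Fintype.card_fin p)
  rw [norm_smul, mul_pow, norm_inv, Real.norm_natCast, inv_pow, inv_mul_le_iff₀ (by positivity)]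
  calc _ ≤ _ := h
    _ ≤ p * (l * p * m) := by rw [hL]; gcongr
    _ = _ := by ring

lemma mul_card_ne_one_le_groupLoss {T : G →* (E ≃ₗᵢ[ℝ] E)} {θ : E} {m : ℝ}
    (hgap : ∀ g, g ≠ 1 → m ≤ gap T θ g) (w : Fin p → G) (S : Finset (Fin p))
    (hS : ∀ j ∈ S, w j ≠ 1) : S.card * m ≤ groupLoss T θ w := by
  calc S.card * m = ∑ _j ∈ S, m := by simp
    _ ≤ ∑ j ∈ S, gap T θ (w j) := Finset.sum_le_sum fun j hj => hgap _ (hS j hj)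
    _ ≤ _ := Finset.sum_le_sum_of_subset_of_nonneg (Finset.subset_univ S)
      fun _ _ _ => gap_nonneg _ _ _

/-- A nonzero displacement has norm at least `√m`, so `√m` times its norm is at most its square.
Hence the sum has norm at most loss`/√m`, and one of the two loss factors is traded for `b * p * m`.
-/
lemma norm_sum_signal_sq_le {T : G →* (E ≃ₗᵢ[ℝ] E)} {θ : E} {m b : ℝ} (hm : 0 < m)
    (hgap : ∀ g, g ≠ 1 → m ≤ gap T θ g) (w : Fin p → G)
    (hw : groupLoss T θ w ≤ b * p * m) :
    ‖∑ j, (T (w j)⁻¹ θ - θ)‖ ^ 2 ≤ b * p * groupLoss T θ w := by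
  have h1 : √m * ‖∑ j, (T (w j)⁻¹ θ - θ)‖ ≤ groupLoss T θ w := by
    calc _ ≤ √m * ∑ j, ‖T (w j)⁻¹ θ - θ‖ := by gcongr; exact norm_sum_le _ _
      _ = ∑ j, √m * ‖T (w j)⁻¹ θ - θ‖ := Finset.mul_sum _ _ _
      _ ≤ _ := by
        refine Finset.sum_le_sum fun j _ => ?_
        rcases eq_or_ne (w j) 1 with h | h
        · simp [h, gap]
        · rw [← norm_map_inv_sub_sq, sq]
          gcongr
          rw [Real.sqrt_le_left (norm_nonneg _), norm_map_inv_sub_sq]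
          exact hgap _ h
  have h2 : m * ‖∑ j, (T (w j)⁻¹ θ - θ)‖ ^ 2 ≤ groupLoss T θ w ^ 2 := by
    rw [← Real.sq_sqrt hm.le, ← mul_pow]
    gcongr
  have h3 : groupLoss T θ w ^ 2 ≤ m * (b * p * groupLoss T θ w) := by
    nlinarith [mul_le_mul_of_nonneg_right hw (groupLoss_nonneg T θ w)]
  exact le_of_mul_le_mul_left (h2.trans h3) hm

/-- Only misaligned indices contribute, and there are at most loss`/m` of them; the factor `m` in
the noise level cancels. -/
lemma NoiseBound.norm_sum_sub_sq_le {T : G →* (E ≃ₗᵢ[ℝ] E)} {θ : E} {l m : ℝ} {x : Fin p → E}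
    (hl : 0 ≤ l) (hm : 0 < m) (hx : NoiseBound T (l * p * m) x)
    (hgap : ∀ g, g ≠ 1 → m ≤ gap T θ g) (w : Fin p → G) :
    ‖∑ j, (T (w j)⁻¹ (x j) - x j)‖ ^ 2 ≤ 4 * l * p * groupLoss T θ w := by
  classical
  set S := Finset.univ.filter fun j => w j ≠ 1 with hS
  have h0 : ∑ j, (T (w j)⁻¹ (x j) - x j) = ∑ j ∈ S, (T (w j)⁻¹ (x j) - x j) := by
    symm
    refine Finset.sum_subset (Finset.subset_univ _) fun j _ hj => ?_
    have : w j = 1 := by simpa [hS] using hj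
    simp [this]
  have h1 : ∀ a, ∑ j, ⟪T (w j)⁻¹ (x j) - x j, a⟫ ^ 2 ≤ 4 * (l * p * m) * ‖a‖ ^ 2 := by
    intro a
    convert! hx.sum_inner_sub_sq_le w a using 3 with j
    rw [inner_sub_left, inner_sub_right, inner_map_inv]
  rw [h0]
  refine (norm_sum_sq_le_of_sum_inner_sq_le (by positivity) h1 S).trans ?_
  have h2 := mul_card_ne_one_le_groupLoss hgap w S (fun j hj => by simpa [hS] using hj)
  have h3 := mul_le_mul_of_nonneg_left h2 (show 0 ≤ 4 * l * p by positivity)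
  linarith

/-- Decomposition of the estimator into the truth, the mean noise and the alignment error. -/
lemma groupEstimate_eq (T : G →* (E ≃ₗᵢ[ℝ] E)) (θ : E) (x : Fin p → E) (w : Fin p → G)
    (hp : 1 ≤ p) :
    groupEstimate T θ x w = θ + (p : ℝ)⁻¹ • ∑ j, x j +
      (p : ℝ)⁻¹ • (∑ j, (T (w j)⁻¹ θ - θ) + ∑ j, (T (w j)⁻¹ (x j) - x j)) := by
  have hp' : (p : ℝ) ≠ 0 := by exact_mod_cast (by omega : p ≠ 0)
  have h : (p : ℝ)⁻¹ • ∑ _j : Fin p, θ = θ := by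
    rw [Finset.sum_const, Finset.card_univ, Fintype.card_fin, ← Nat.cast_smul_eq_nsmul ℝ,
      smul_smul, inv_mul_cancel₀ hp', one_smul]
  nth_rw 2 [← h]
  simp only [groupEstimate, ← smul_add, ← Finset.sum_add_distrib, map_add]
  congr 1
  refine Finset.sum_congr rfl fun j _ => ?_
  abel

lemma norm_alignment_error_sq_le {T : G →* (E ≃ₗᵢ[ℝ] E)} {θ : E} {l m b : ℝ} {x : Fin p → E}
    (hp : 1 ≤ p) (hl : 0 ≤ l) (hm : 0 < m) (hx : NoiseBound T (l * p * m) x)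
    (hgap : ∀ g, g ≠ 1 → m ≤ gap T θ g) (w : Fin p → G)
    (hw : groupLoss T θ w ≤ b * p * m) :
    p * ‖(p : ℝ)⁻¹ • (∑ j, (T (w j)⁻¹ θ - θ) + ∑ j, (T (w j)⁻¹ (x j) - x j))‖ ^ 2 ≤
      2 * (b + 4 * l) * groupLoss T θ w := by
  have hp' : (0 : ℝ) < p := by exact_mod_cast hp
  have h1 := norm_sum_signal_sq_le hm hgap w hw
  have h2 := hx.norm_sum_sub_sq_le hl hm hgap w
  have h3 := norm_add_le (∑ j, (T (w j)⁻¹ θ - θ)) (∑ j, (T (w j)⁻¹ (x j) - x j))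
  have h4 : ‖∑ j, (T (w j)⁻¹ θ - θ) + ∑ j, (T (w j)⁻¹ (x j) - x j)‖ ^ 2 ≤
      p * (2 * (b + 4 * l) * groupLoss T θ w) := by
    refine (pow_le_pow_left₀ (norm_nonneg _) h3 2).trans ((add_sq_le).trans ?_)
    linarith
  rw [norm_smul, mul_pow, norm_inv, Real.norm_natCast]
  calc _ ≤ (p : ℝ) * ((p : ℝ)⁻¹ ^ 2 * (p * (2 * (b + 4 * l) * groupLoss T θ w))) := by gcongr
    _ = _ := by field_simp

lemma inner_map_sub_nonneg_of_norm_le (f : E ≃ₗᵢ[ℝ] E) {z h : E}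
    (hz : ‖z - f h‖ ^ 2 ≤ ‖z - h‖ ^ 2) : 0 ≤ ⟪z, f h - h⟫ := by
  rw [norm_sub_sq_real, norm_sub_sq_real, f.norm_map] at hz
  rw [inner_sub_right]
  linarith

/-- A single observation: if `g` beats the identity, then either the observation lies in the
misalignment set or the alignment error `e` has a large inner product with the noise. -/
lemma gap_le_indicator_add {T : G →* (E ≃ₗᵢ[ℝ] E)} {θ : E} {m q r : ℝ} {x : Fin p → E}
    (hm : 0 < m) (hq : 0 < q) (hgap : ∀ g, g ≠ 1 → m ≤ gap T θ g) (j : Fin p) (g : G) (e : E)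
    (hV : ‖looMean x j‖ ≤ r) (hmean : ‖(p : ℝ)⁻¹ • ∑ i, x i‖ ≤ q / 2 * √m)
    (he : ‖e‖ ≤ q / 2 * √m)
    (hg : ‖θ + x j - T g (θ + (p : ℝ)⁻¹ • ∑ i, x i + e)‖ ^ 2 ≤
      ‖θ + x j - (θ + (p : ℝ)⁻¹ • ∑ i, x i + e)‖ ^ 2) :
    gap T θ g ≤ (misalignSet T θ r (1 / 2 - 2 * q) j g).indicator (fun _ => gap T θ g) x +
      ⟪x j, T g e - e⟫ ^ 2 / (q ^ 2 * m) := by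
  classical
  have hfrac : 0 ≤ ⟪x j, T g e - e⟫ ^ 2 / (q ^ 2 * m) := by positivity
  rcases eq_or_ne g 1 with rfl | hg1
  · have : 0 ≤ (misalignSet T θ r (1 / 2 - 2 * q) j 1).indicator (fun _ => gap T θ 1) x :=
      Set.indicator_nonneg (fun _ _ => gap_nonneg _ _ _) _
    rw [gap_one] at *
    linarith
  set y := (p : ℝ)⁻¹ • ∑ i, x i with hy
  set V := looMean x j with hVdef
  -- Splitting off the share of `x j` in the mean removes the dependence between the noise and the
  -- centre.
  have hyV : y = V + (p : ℝ)⁻¹ • x j := by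
    rw [hy, hVdef, looMean, ← smul_add, Finset.sum_erase_add _ _ (Finset.mem_univ j)]
  have h0 := inner_map_sub_nonneg_of_norm_le (T g) hg
  have hθ : ⟪θ, T g θ - θ⟫ = -(1 / 2) * gap T θ g := by
    rw [gap, norm_sub_sq_real, (T g).norm_map, inner_sub_right, real_inner_self_eq_norm_sq,
      real_inner_comm]
    ring
  have hk : ⟪θ, T g (y + e) - (y + e)⟫ ≤ q * gap T θ g := by
    have h1 : ⟪θ, T g (y + e) - (y + e)⟫ = ⟪T g⁻¹ θ - θ, y + e⟫ := by
      rw [inner_sub_right, inner_sub_left, inner_map_inv]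
    have h2 : ‖T g⁻¹ θ - θ‖ = √(gap T θ g) := by
      rw [← norm_map_inv_sub_sq, Real.sqrt_sq (norm_nonneg _)]
    have h3 : ‖y + e‖ ≤ q * √(gap T θ g) := by
      calc _ ≤ q * √m := (norm_add_le _ _).trans (by linarith)
        _ ≤ _ := by gcongr; exact hgap g hg1
    rw [h1]
    calc _ ≤ _ := real_inner_le_norm _ _
      _ ≤ √(gap T θ g) * (q * √(gap T θ g)) := by rw [h2]; gcongr
      _ = q * (√(gap T θ g) * √(gap T θ g)) := by ring
      _ = _ := by rw [Real.mul_self_sqrt (gap_nonneg _ _ _)]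
  have hself : ⟪x j, T g ((p : ℝ)⁻¹ • x j) - (p : ℝ)⁻¹ • x j⟫ ≤ 0 := by
    rw [map_smul, ← smul_sub, real_inner_smul_right]
    exact mul_nonpos_of_nonneg_of_nonpos (by positivity) (inner_map_sub_self_nonpos _ _)
  have hsplit : ⟪θ + x j, T g (θ + y + e) - (θ + y + e)⟫ =
      ⟪θ, T g θ - θ⟫ + ⟪θ, T g (y + e) - (y + e)⟫ +
      ⟪x j, T g (θ + V) - (θ + V)⟫ + ⟪x j, T g ((p : ℝ)⁻¹ • x j) - (p : ℝ)⁻¹ • x j⟫ +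
      ⟪x j, T g e - e⟫ := by
    rw [hyV]
    simp only [map_add, inner_add_left, inner_add_right, inner_sub_right]
    ring
  rw [hsplit, hθ] at h0
  -- If the term with `e` is small, the two errors of size `q * gap` lower the threshold from `1/2`
  -- to `1/2 - 2q`. Otherwise its square dominates `q² * gap²`, hence `q² * m * gap`.
  by_cases ht : ⟪x j, T g e - e⟫ ≤ q * gap T θ g
  · have hmem : x ∈ misalignSet T θ r (1 / 2 - 2 * q) j g := ⟨hV, by linarith⟩
    rw [Set.indicator_of_mem hmem]
    linarith
  · push Not at ht
    have hi : 0 ≤ (misalignSet T θ r (1 / 2 - 2 * q) j g).indicator (fun _ => gap T θ g) x :=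
      Set.indicator_nonneg (fun _ _ => gap_nonneg _ _ _) _
    have hgm := hgap g hg1
    have : gap T θ g ≤ ⟪x j, T g e - e⟫ ^ 2 / (q ^ 2 * m) := by
      rw [le_div_iff₀ (by positivity)]
      calc gap T θ g * (q ^ 2 * m) ≤ gap T θ g * (q ^ 2 * gap T θ g) := by
            gcongr; exact gap_nonneg _ _ _
        _ = (q * gap T θ g) ^ 2 := by ring
        _ ≤ _ := by
          gcongr
          exact mul_nonneg hq.le (gap_nonneg _ _ _)
    linarith

/-- One iteration halves the loss up to the excess term. -/
theorem groupLoss_le_excess_add_half [Fintype G] {T : G →* (E ≃ₗᵢ[ℝ] E)} {θ : E}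
    {l m b q : ℝ} {x : Fin p → E} (hp : 1 ≤ p) (hl : 0 ≤ l) (hb : 0 ≤ b) (hm : 0 < m) (hq : 0 < q)
    (hlq : l ≤ (q / 2) ^ 2) (hbq : 2 * (b + 4 * l) * b ≤ (q / 2) ^ 2)
    (hlbq : 4 * l * (2 * (b + 4 * l)) ≤ q ^ 2 / 2)
    (hx : NoiseBound T (l * p * m) x) (hgap : ∀ g, g ≠ 1 → m ≤ gap T θ g) (w w' : Fin p → G)
    (hw : groupLoss T θ w ≤ b * p * m)
    (hw' : ∀ j, ‖θ + x j - T (w' j) (groupEstimate T θ x w)‖ ^ 2 ≤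
      ‖θ + x j - groupEstimate T θ x w‖ ^ 2) :
    groupLoss T θ w' ≤ excess T θ √(l * m) (1 / 2 - 2 * q) x + 1 / 2 * groupLoss T θ w := by
  have hp' : (0 : ℝ) < p := by exact_mod_cast hp
  have hmean (S : Finset (Fin p)) := hx.norm_mean_sq_le hp (by positivity) S
  have hdec := groupEstimate_eq T θ x w hp
  have herr := norm_alignment_error_sq_le hp hl hm hx hgap w hw
  set e := (p : ℝ)⁻¹ • (∑ j, (T (w j)⁻¹ θ - θ) + ∑ j, (T (w j)⁻¹ (x j) - x j)) with he
  have hq2 : (q / 2 * √m) ^ 2 = (q / 2) ^ 2 * m := by rw [mul_pow, Real.sq_sqrt hm.le]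
  have h1 : ‖(p : ℝ)⁻¹ • ∑ i, x i‖ ≤ q / 2 * √m := by
    refine le_of_sq_le_sq ?_ (by positivity)
    rw [hq2]
    exact (hmean _).trans (by gcongr)
  have h2 : ‖e‖ ≤ q / 2 * √m := by
    refine le_of_sq_le_sq ?_ (by positivity)
    rw [hq2]
    refine le_of_mul_le_mul_left ?_ hp'
    calc _ ≤ _ := herr
      _ ≤ 2 * (b + 4 * l) * (b * p * m) := by gcongr
      _ = p * ((2 * (b + 4 * l) * b) * m) := by ring
      _ ≤ _ := by gcongr
  have hterm (j : Fin p) := gap_le_indicator_add (T := T) (θ := θ) (r := √(l * m)) hm hq hgap j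
    (w' j) e (Real.le_sqrt_of_sq_le (hmean _)) h1 h2 (by rw [← hdec]; exact hw' j)
  have hA : ∑ j, (misalignSet T θ √(l * m) (1 / 2 - 2 * q) j (w' j)).indicator
      (fun _ => gap T θ (w' j)) x ≤ excess T θ √(l * m) (1 / 2 - 2 * q) x :=
    Finset.sum_le_sum fun j _ => Finset.single_le_sum
      (f := fun g => (misalignSet T θ √(l * m) (1 / 2 - 2 * q) j g).indicator
        (fun _ => gap T θ g) x)
      (fun g _ => Set.indicator_nonneg (fun _ _ => gap_nonneg _ _ _) _) (Finset.mem_univ (w' j))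
  have hB : ∑ j, ⟪x j, T (w' j) e - e⟫ ^ 2 / (q ^ 2 * m) ≤ 1 / 2 * groupLoss T θ w := by
    rw [← Finset.sum_div, div_le_iff₀ (by positivity)]
    calc _ ≤ _ := hx.sum_inner_sub_sq_le w' e
      _ = 4 * l * m * (p * ‖e‖ ^ 2) := by ring
      _ ≤ 4 * l * m * (2 * (b + 4 * l) * groupLoss T θ w) := by gcongr
      _ = (4 * l * (2 * (b + 4 * l))) * (m * groupLoss T θ w) := by ring
      _ ≤ q ^ 2 / 2 * (m * groupLoss T θ w) := by
        gcongr
        exact mul_nonneg hm.le (groupLoss_nonneg _ _ _)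
      _ = _ := by ring
  calc groupLoss T θ w' ≤ _ := Finset.sum_le_sum fun j _ => hterm j
    _ = _ := Finset.sum_add_distrib
    _ ≤ _ := add_le_add hA hB

end Deterministic

/-! ### Gaussian estimates: operator norm of the noise and tails of the misalignment events -/

section Gaussian

/-- The integral equals `(1 - v)^(-1/2)`, and `(3/4)^(-1/2) ≤ 6/5`. -/
lemma lintegral_exp_sq_gaussianReal_le {v : NNReal} (hv : v ≤ 1 / 4) :
    ∫⁻ x, ENNReal.ofReal (Real.exp (1 / 2 * x ^ 2)) ∂(gaussianReal 0 v) ≤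
      ENNReal.ofReal (6 / 5) := by
  rcases eq_or_ne v 0 with rfl | h0
  · rw [gaussianReal_zero_var, lintegral_dirac]
    exact ENNReal.ofReal_le_ofReal (by norm_num)
  have hv0 : (0 : ℝ) < v := by exact_mod_cast pos_iff_ne_zero.mpr h0
  have hv4 : (v : ℝ) ≤ 1 / 4 := by exact_mod_cast hv
  have hb : 0 < (1 - (v : ℝ)) / (2 * v) := by
    apply div_pos <;> linarith
  have hint := (integrable_exp_neg_mul_sq hb).const_mul (√(2 * Real.pi * v))⁻¹
  have hpdf : ∀ x : ℝ, gaussianPDF 0 v x * ENNReal.ofReal (Real.exp (1 / 2 * x ^ 2)) =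
      ENNReal.ofReal ((√(2 * Real.pi * v))⁻¹ * Real.exp (-((1 - (v : ℝ)) / (2 * v)) * x ^ 2)) := by
    intro x
    rw [gaussianPDF, ← ENNReal.ofReal_mul (gaussianPDFReal_nonneg _ _ _), gaussianPDFReal, mul_assoc,
      ← Real.exp_add]
    congr 3
    field_simp
    ring
  rw [gaussianReal_of_var_ne_zero _ h0,
    lintegral_withDensity_eq_lintegral_mul _ (measurable_gaussianPDF _ _) (by fun_prop)]
  simp only [Pi.mul_apply, hpdf]
  rw [← ofReal_integral_eq_lintegral_ofReal hint (ae_of_all _ fun x => by positivity),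
    integral_const_mul, integral_gaussian]
  apply ENNReal.ofReal_le_ofReal
  have hs : 0 < √(2 * Real.pi * v) := by positivity
  rw [inv_mul_le_iff₀ hs]
  apply Real.sqrt_le_iff.mpr ⟨by positivity, ?_⟩
  rw [mul_pow, Real.sq_sqrt (by positivity), div_le_iff₀ hb]
  have : 2 * Real.pi * v * (6 / 5) ^ 2 * ((1 - (v : ℝ)) / (2 * v)) =
    Real.pi * ((6 / 5) ^ 2 * (1 - v)) := by field_simp
  rw [this]
  nlinarith [Real.pi_pos]

variable {E : Type*} [NormedAddCommGroup E] [InnerProductSpace ℝ E] [FiniteDimensional ℝ E]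
  [MeasurableSpace E] [BorelSpace E]

lemma stdGaussian_map_inner (v : E) :
    (stdGaussian E).map (fun x => ⟪x, v⟫) = gaussianReal 0 (‖v‖₊ ^ 2) := by
  have h := IsGaussian.map_eq_gaussianReal (μ := stdGaussian E) (innerSL ℝ v)
  rw [integral_strongDual_stdGaussian, variance_dual_stdGaussian, innerSL_apply_norm] at h
  have h2 : (‖v‖ ^ 2).toNNReal = ‖v‖₊ ^ 2 := by
    rw [Real.toNNReal_pow (norm_nonneg _), norm_toNNReal]
  rw [← h2, ← h]
  congr 1
  ext x
  simp [real_inner_comm]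

lemma lintegral_exp_inner_sq_stdGaussian_le {v : E} (hv : ‖v‖ ≤ 1 / 2) :
    ∫⁻ x, ENNReal.ofReal (Real.exp (1 / 2 * ⟪x, v⟫ ^ 2)) ∂(stdGaussian E) ≤
      ENNReal.ofReal (6 / 5) := by
  have h := lintegral_map (μ := stdGaussian E)
    (f := fun t : ℝ => ENNReal.ofReal (Real.exp (1 / 2 * t ^ 2)))
    (g := fun x => ⟪x, v⟫) (by fun_prop) (by fun_prop)
  rw [← h, stdGaussian_map_inner]
  apply lintegral_exp_sq_gaussianReal_le
  have : ‖v‖₊ ≤ 1 / 2 := by exact_mod_cast hv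
  calc ‖v‖₊ ^ 2 ≤ (1 / 2) ^ 2 := by gcongr
    _ = 1 / 4 := by norm_num

lemma stdGaussian_inner_ge_le {v : E} {c s : ℝ} (hc : 0 ≤ c) (hs : 0 < s) (hv : ‖v‖ ≤ s) :
    stdGaussian E {x | c ≤ ⟪x, v⟫} ≤ ENNReal.ofReal (Real.exp (-(c ^ 2 / (2 * s ^ 2)))) := by
  have hmap := stdGaussian_map_inner v
  have hmgf := mgf_gaussianReal hmap (c / s ^ 2)
  have hint : Integrable (fun x => Real.exp (c / s ^ 2 * ⟪x, v⟫)) (stdGaussian E) := by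
    have h := integrable_exp_mul_gaussianReal (μ := 0) (v := ‖v‖₊ ^ 2) (c / s ^ 2)
    rw [← hmap] at h
    exact h.comp_measurable (by fun_prop)
  -- Chernoff's bound with the parameter `c / s²` that is optimal for variance `s²`.
  have h := measure_ge_le_exp_mul_mgf (μ := stdGaussian E) (X := fun x => ⟪x, v⟫) c
    (t := c / s ^ 2) (by positivity) hint
  rw [hmgf, ← Real.exp_add] at h
  rw [← ofReal_measureReal]
  refine ENNReal.ofReal_le_ofReal (h.trans (Real.exp_le_exp.mpr ?_))
  have hv2 : ‖v‖ ^ 2 ≤ s ^ 2 := by gcongr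
  push_cast
  have h3 : ‖v‖ ^ 2 * (c / s ^ 2) ^ 2 / 2 ≤ s ^ 2 * (c / s ^ 2) ^ 2 / 2 := by gcongr
  have h4 : s ^ 2 * (c / s ^ 2) ^ 2 / 2 = c ^ 2 / (2 * s ^ 2) := by field_simp
  have h5 : -(c / s ^ 2) * c = - 2 * (c ^ 2 / (2 * s ^ 2)) := by field_simp
  rw [h5]
  linarith

/-- The law of `p` independent standard Gaussian vectors. -/
abbrev noiseLaw (p : ℕ) (E : Type*) [NormedAddCommGroup E] [InnerProductSpace ℝ E]
    [FiniteDimensional ℝ E] [MeasurableSpace E] : Measure (Fin p → E) :=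
  Measure.pi fun _ => stdGaussian E

variable {p : ℕ}

lemma iIndepFun_eval_noiseLaw : iIndepFun (fun (j : Fin p) (x : Fin p → E) => x j) (noiseLaw p E) :=
  iIndepFun_pi (X := fun _ => id) (fun _ => aemeasurable_id)

lemma lintegral_prod_noiseLaw {f : E → ENNReal} (hf : Measurable f) :
    ∫⁻ x, ∏ j, f (x j) ∂(noiseLaw p E) = (∫⁻ y, f y ∂(stdGaussian E)) ^ p := by
  have h := lintegral_prod_eq_prod_lintegral_of_indepFun Finset.univ
    (fun (j : Fin p) (x : Fin p → E) => f (x j))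
    (iIndepFun_eval_noiseLaw.comp (fun _ => f) (fun _ => hf)) (fun j => by fun_prop)
  rw [h]
  have h2 (j : Fin p) : ∫⁻ x, f (x j) ∂(noiseLaw p E) = ∫⁻ y, f y ∂(stdGaussian E) :=
    (measurePreserving_eval (fun _ : Fin p => stdGaussian E) j).lintegral_comp hf
  simp [h2]

/-- An integral over directions replaces a net. Near a quarter of a bad unit vector `a`, the
quadratic form is large on average over each pair of points symmetric about `a / 4`. The product of
sums over `g` dominates the term of the bad alignment `u`, so it takes care of the union over all
alignments. -/
lemma lintegral_ball_ge_of_le_sum_inner_sq {G : Type*} [Group G] [Fintype G]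
    (T : G →* (E ≃ₗᵢ[ℝ] E)) {L : ℝ} {x : Fin p → E} (hx : ¬ NoiseBound T L x) :
    ENNReal.ofReal (Real.exp (L / 32)) * volume (Metric.ball (0 : E) (1 / 4)) ≤
      ∫⁻ a in Metric.ball (0 : E) (1 / 2),
        ∏ j, ∑ g, ENNReal.ofReal (Real.exp (1 / 2 * ⟪x j, T g a⟫ ^ 2)) := by
  obtain ⟨u, a, hua⟩ : ∃ (u : Fin p → G) (a : E), ‖a‖ = 1 ∧ L ≤ ∑ j, ⟪x j, T (u j) a⟫ ^ 2 := by
    simp only [NoiseBound, not_forall, not_le] at hx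
    obtain ⟨u, a, h⟩ := hx
    have ha : a ≠ 0 := by
      rintro rfl
      simp at h
    have ha' : 0 < ‖a‖ := norm_pos_iff.mpr ha
    refine ⟨u, ‖a‖⁻¹ • a, by simp [norm_smul, ha'.ne'], ?_⟩
    simp only [map_smul, real_inner_smul_right, mul_pow, ← Finset.mul_sum]
    rw [inv_pow, inv_mul_eq_div, le_div_iff₀ (by positivity)]
    exact h.le
  obtain ⟨ha, hL⟩ := hua
  set q : E → ℝ := fun b => ∑ j, ⟪x j, T (u j) b⟫ ^ 2 with hq
  have hqc : Continuous q := by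
    simp only [hq]
    fun_prop
  set c : E := (1 / 4 : ℝ) • a with hc
  set B := Metric.ball c (1 / 4) with hB
  have hcn : ‖c‖ = 1 / 4 := by rw [hc, norm_smul, ha]; norm_num
  set f : E → ENNReal := B.indicator fun b => ENNReal.ofReal (Real.exp (1 / 2 * q b)) with hf
  have hfm : Measurable f := by
    refine Measurable.indicator ?_ Metric.isOpen_ball.measurableSet
    exact ENNReal.measurable_ofReal.comp (Real.continuous_exp.comp (hqc.const_mul _)).measurable
  -- Reflection through the centre `c` preserves volume. The parallelogram inequality gives `q b + q
  -- (2c - b) ≥ 2 q c ≥ L / 8`, and the arithmetic-geometric mean inequality turns this into `exp (L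
  -- / 32)`.
  have hrefl : ∫⁻ b, f ((2 : ℝ) • c - b) = ∫⁻ b, f b :=
    lintegral_sub_left_eq_self f ((2 : ℝ) • c)
  have hpt (b : E) : B.indicator (fun _ => 2 * ENNReal.ofReal (Real.exp (L / 32))) b ≤
      f b + f ((2 : ℝ) • c - b) := by
    by_cases hb : b ∈ B
    · have hb' : (2 : ℝ) • c - b ∈ B := by
        rw [hB, mem_ball_iff_norm] at hb ⊢
        rwa [two_smul, show c + c - b - c = -(b - c) by abel, norm_neg]
      rw [hf, Set.indicator_of_mem hb, Set.indicator_of_mem hb, Set.indicator_of_mem hb',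
        ← ENNReal.ofReal_add (by positivity) (by positivity),
        show (2 : ENNReal) = ENNReal.ofReal 2 by simp, ← ENNReal.ofReal_mul (by norm_num)]
      apply ENNReal.ofReal_le_ofReal
      have hsum : L / 8 ≤ q b + q ((2 : ℝ) • c - b) := by
        calc L / 8 ≤ (∑ j, ⟪x j, T (u j) a⟫ ^ 2) / 8 := by linarith
          _ = ∑ j, ⟪x j, T (u j) a⟫ ^ 2 / 8 := Finset.sum_div _ _ _
          _ ≤ ∑ j, (⟪x j, T (u j) b⟫ ^ 2 + ⟪x j, T (u j) ((2 : ℝ) • c - b)⟫ ^ 2) := by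
            refine Finset.sum_le_sum fun j _ => ?_
            rw [map_sub, inner_sub_right, hc, map_smul, map_smul, real_inner_smul_right,
              real_inner_smul_right]
            nlinarith [sq_nonneg (2 * ⟪x j, T (u j) b⟫ - 1 / 2 * ⟪x j, T (u j) a⟫)]
          _ = _ := Finset.sum_add_distrib
      set s := Real.exp (1 / 4 * q b) with hs
      set t := Real.exp (1 / 4 * q ((2 : ℝ) • c - b)) with ht
      have h1 : Real.exp (1 / 2 * q b) = s * s := by rw [hs, ← Real.exp_add]; congr 1; ring
      have h2 : Real.exp (1 / 2 * q ((2 : ℝ) • c - b)) = t * t := by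
        rw [ht, ← Real.exp_add]; congr 1; ring
      have h3 : Real.exp (L / 32) ≤ s * t := by
        rw [hs, ht, ← Real.exp_add]
        apply Real.exp_le_exp.mpr
        linarith
      rw [h1, h2]
      nlinarith [sq_nonneg (s - t)]
    · rw [Set.indicator_of_notMem hb]
      exact zero_le
  have hvol : volume B = volume (Metric.ball (0 : E) (1 / 4)) := Measure.addHaar_ball_center _ _ _
  have hmain : 2 * (ENNReal.ofReal (Real.exp (L / 32)) * volume (Metric.ball (0 : E) (1 / 4))) ≤
      2 * ∫⁻ b, f b := by
    calc _ = ∫⁻ b, B.indicator (fun _ => 2 * ENNReal.ofReal (Real.exp (L / 32))) b := by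
          rw [lintegral_indicator_const Metric.isOpen_ball.measurableSet, hvol, mul_assoc]
      _ ≤ ∫⁻ b, (f b + f ((2 : ℝ) • c - b)) := lintegral_mono hpt
      _ = (∫⁻ b, f b) + ∫⁻ b, f ((2 : ℝ) • c - b) := lintegral_add_left hfm _
      _ = _ := by rw [hrefl, two_mul]
  have hmain' := (ENNReal.mul_le_mul_iff_right (by simp) (by simp)).mp hmain
  refine hmain'.trans ?_
  rw [hf, lintegral_indicator Metric.isOpen_ball.measurableSet]
  calc _ ≤ ∫⁻ b in Metric.ball (0 : E) (1 / 2), ENNReal.ofReal (Real.exp (1 / 2 * q b)) := by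
        refine lintegral_mono_set fun b hb => ?_
        rw [mem_ball_iff_norm] at hb
        rw [mem_ball_zero_iff]
        have := norm_add_le (b - c) c
        rw [sub_add_cancel, hcn] at this
        linarith
    _ ≤ _ := by
        refine lintegral_mono fun b => ?_
        simp only [hq]
        rw [Finset.mul_sum, Real.exp_sum, ENNReal.ofReal_prod_of_nonneg (fun _ _ => by positivity)]
        refine Finset.prod_le_prod' fun j _ => ?_
        exact Finset.single_le_sum (f := fun g => ENNReal.ofReal (Real.exp (1 / 2 * ⟪x j, T g b⟫ ^ 2)))
          (fun _ _ => zero_le) (Finset.mem_univ (u j))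

/-- Markov's inequality for the integral over the ball of radius `1/2`. By Tonelli and independence
its mean is at most `(card G * 6/5) ^ p` times the volume of that ball; the ratio of volumes of the
two balls gives `2 ^ finrank`. -/
theorem noiseLaw_not_noiseBound_le {G : Type*} [Group G] [Fintype G]
    (T : G →* (E ≃ₗᵢ[ℝ] E)) (L : ℝ) :
    noiseLaw p E {x | ¬ NoiseBound T L x} ≤
      ENNReal.ofReal (2 ^ Module.finrank ℝ E * (Fintype.card G * (6 / 5)) ^ p *
        Real.exp (-(L / 32))) := by
  set F : (Fin p → E) → ENNReal := fun x => ∫⁻ a in Metric.ball (0 : E) (1 / 2),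
    ∏ j, ∑ g, ENNReal.ofReal (Real.exp (1 / 2 * ⟪x j, T g a⟫ ^ 2)) with hF
  set v := volume (Metric.ball (0 : E) (1 / 4)) with hv
  have hv0 : v ≠ 0 := (Metric.measure_ball_pos _ _ (by norm_num)).ne'
  have hvt : v ≠ ⊤ := measure_ball_lt_top.ne
  have hvol : volume (Metric.ball (0 : E) (1 / 2)) =
      ENNReal.ofReal (2 ^ Module.finrank ℝ E) * v := by
    rw [hv, ← Measure.addHaar_ball_mul_of_pos _ 0 (by norm_num)]
    norm_num
  have hmeas : Measurable fun z : (Fin p → E) × E =>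
      ∏ j, ∑ g, ENNReal.ofReal (Real.exp (1 / 2 * ⟪z.1 j, T g z.2⟫ ^ 2)) := by
    refine Finset.measurable_prod _ fun j _ => Finset.measurable_sum _ fun g _ => ?_
    have : Measurable fun z : (Fin p → E) × E => ⟪z.1 j, T g z.2⟫ :=
      Measurable.inner (by fun_prop) ((T g).continuous.measurable.comp measurable_snd)
    fun_prop
  have hFm : Measurable F := hmeas.lintegral_prod_right'
  have hFint : ∫⁻ x, F x ∂(noiseLaw p E) ≤
      (Fintype.card G * ENNReal.ofReal (6 / 5)) ^ p * (ENNReal.ofReal (2 ^ Module.finrank ℝ E) * v) := by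
    rw [hF, lintegral_lintegral_swap hmeas.aemeasurable, ← hvol, ← setLIntegral_const]
    refine setLIntegral_mono measurable_const fun a ha => ?_
    have hm : ∀ g, Measurable fun y : E => ENNReal.ofReal (Real.exp (1 / 2 * ⟪y, T g a⟫ ^ 2)) :=
      fun g => by fun_prop
    rw [lintegral_prod_noiseLaw
      (f := fun y => ∑ g, ENNReal.ofReal (Real.exp (1 / 2 * ⟪y, T g a⟫ ^ 2))) (by fun_prop),
      lintegral_finsetSum _ (fun g _ => hm g)]
    gcongr
    calc _ ≤ ∑ _g : G, ENNReal.ofReal (6 / 5) := by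
          refine Finset.sum_le_sum fun g _ => lintegral_exp_inner_sq_stdGaussian_le ?_
          rw [LinearIsometryEquiv.norm_map]
          exact (mem_ball_zero_iff.mp ha).le
      _ = _ := by simp
  have he0 : ENNReal.ofReal (Real.exp (L / 32)) ≠ 0 := by
    simpa using Real.exp_pos _
  calc noiseLaw p E {x | ¬ NoiseBound T L x}
      ≤ noiseLaw p E {x | ENNReal.ofReal (Real.exp (L / 32)) * v ≤ F x} :=
        measure_mono fun x hx => lintegral_ball_ge_of_le_sum_inner_sq T hx
    _ ≤ (∫⁻ x, F x ∂(noiseLaw p E)) / (ENNReal.ofReal (Real.exp (L / 32)) * v) :=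
        meas_ge_le_lintegral_div hFm.aemeasurable (mul_ne_zero he0 hv0)
          (ENNReal.mul_ne_top ENNReal.ofReal_ne_top hvt)
    _ ≤ _ := by
      rw [ENNReal.div_le_iff (mul_ne_zero he0 hv0) (ENNReal.mul_ne_top ENNReal.ofReal_ne_top hvt)]
      refine hFint.trans_eq ?_
      have h1 : (Fintype.card G : ENNReal) = ENNReal.ofReal (Fintype.card G) := by simp
      rw [h1, ← ENNReal.ofReal_mul (by positivity), ← ENNReal.ofReal_pow (by positivity),
        ← mul_assoc, ← mul_assoc, ← ENNReal.ofReal_mul (by positivity),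
        ← ENNReal.ofReal_mul (by positivity)]
      congr 2
      rw [mul_assoc _ (Real.exp _) (Real.exp _), ← Real.exp_add]
      simp [mul_comm]

/-- The leave-one-out means are independent of the omitted vector. -/
lemma noiseLaw_prodMk_mem_le {j : Fin p} {S : Set (E × E)} (hS : MeasurableSet S) {κ : ENNReal}
    (h : ∀ v, stdGaussian E {y | (v, y) ∈ S} ≤ κ) :
    noiseLaw p E {x | (looMean x j, x j) ∈ S} ≤ κ := by
  have hm : Measurable fun x : Fin p → E => looMean x j := by
    unfold looMean
    fun_prop
  have hind : IndepFun (fun x : Fin p → E => looMean x j) (fun x => x j) (noiseLaw p E) := by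
    have h1 := (iIndepFun_eval_noiseLaw (p := p) (E := E)).indepFun_finsetSum_of_notMem
      (fun j => by fun_prop) (Finset.notMem_erase j Finset.univ)
    have h2 := h1.comp (φ := fun y => (p : ℝ)⁻¹ • y) (ψ := id) (by fun_prop) measurable_id
    convert! h2 using 1
    ext x
    simp [looMean]
  have hmap := (indepFun_iff_map_prod_eq_prod_map_map hm.aemeasurable
    (measurable_pi_apply j).aemeasurable).mp hind
  have hj : (noiseLaw p E).map (fun x => x j) = stdGaussian E :=
    (measurePreserving_eval (fun _ : Fin p => stdGaussian E) j).map_eq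
  have : IsProbabilityMeasure ((noiseLaw p E).map fun x => looMean x j) :=
    Measure.isProbabilityMeasure_map hm.aemeasurable
  calc noiseLaw p E {x | (looMean x j, x j) ∈ S}
      = (noiseLaw p E).map (fun x => (looMean x j, x j)) S :=
        (Measure.map_apply (hm.prodMk (measurable_pi_apply j)) hS).symm
    _ = ∫⁻ v, stdGaussian E (Prod.mk v ⁻¹' S) ∂((noiseLaw p E).map fun x => looMean x j) := by
        rw [hmap, hj, Measure.prod_apply hS]
    _ ≤ ∫⁻ _v, κ ∂((noiseLaw p E).map fun x => looMean x j) := lintegral_mono fun v => h v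
    _ = κ := by simp

variable {G : Type*} [Group G] (T : G →* (E ≃ₗᵢ[ℝ] E))

lemma measurableSet_misalignSet (θ : E) (r c : ℝ) (j : Fin p) (g : G) :
    MeasurableSet (misalignSet T θ r c j g) := by
  have h1 : Continuous fun x : Fin p → E => looMean x j := by
    unfold looMean
    fun_prop
  have hc1 : IsClosed {x : Fin p → E | ‖looMean x j‖ ≤ r} :=
    isClosed_le h1.norm continuous_const
  have hc2 : IsClosed {x : Fin p → E |
      c * gap T θ g ≤ ⟪x j, T g (θ + looMean x j) - (θ + looMean x j)⟫} :=
    isClosed_le continuous_const (by fun_prop)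
  exact (hc1.inter hc2).measurableSet

/-- For a fixed value `v` of the leave-one-out mean, the inner product is a centred Gaussian with
standard deviation at most `√gap + 2‖v‖`. -/
lemma noiseLaw_misalignSet_le {θ : E} {r c s : ℝ} {g : G} (hc : 0 ≤ c) (hs : 0 < s)
    (hr : √(gap T θ g) + 2 * r ≤ s) (j : Fin p) :
    noiseLaw p E (misalignSet T θ r c j g) ≤
      ENNReal.ofReal (Real.exp (-((c * gap T θ g) ^ 2 / (2 * s ^ 2)))) := by
  have hS : MeasurableSet {z : E × E | ‖z.1‖ ≤ r ∧
      c * gap T θ g ≤ ⟪z.2, T g (θ + z.1) - (θ + z.1)⟫} := by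
    have hc1 : IsClosed {z : E × E | ‖z.1‖ ≤ r} := isClosed_le (by fun_prop) continuous_const
    have hc2 : IsClosed {z : E × E | c * gap T θ g ≤ ⟪z.2, T g (θ + z.1) - (θ + z.1)⟫} :=
      isClosed_le continuous_const (by fun_prop)
    exact (hc1.inter hc2).measurableSet
  refine noiseLaw_prodMk_mem_le (j := j) hS fun v => ?_
  by_cases hv : ‖v‖ ≤ r
  · refine (measure_mono fun y hy => hy.2).trans
      (stdGaussian_inner_ge_le (v := T g (θ + v) - (θ + v)) (mul_nonneg hc (gap_nonneg _ _ _)) hs ?_)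
    have h1 : T g (θ + v) - (θ + v) = (T g θ - θ) + (T g v - v) := by
      rw [map_add]; abel
    have h2 : ‖T g v - v‖ ≤ 2 * ‖v‖ := by
      refine (norm_sub_le _ _).trans_eq ?_
      rw [LinearIsometryEquiv.norm_map, two_mul]
    have h3 : √(gap T θ g) = ‖T g θ - θ‖ := Real.sqrt_sq (norm_nonneg _)
    rw [h1]
    refine (norm_add_le _ _).trans ?_
    linarith
  · have : {y : E | (v, y) ∈ {z : E × E | ‖z.1‖ ≤ r ∧
        c * gap T θ g ≤ ⟪z.2, T g (θ + z.1) - (θ + z.1)⟫}} = ∅ := by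
      ext y
      simp [hv]
    rw [this, measure_empty]
    exact zero_le

lemma lintegral_excess_le [Fintype G] {θ : E} {r c κ : ℝ}
    (h : ∀ (j : Fin p) g, ENNReal.ofReal (gap T θ g) * noiseLaw p E (misalignSet T θ r c j g) ≤
      ENNReal.ofReal κ) :
    ∫⁻ x, ENNReal.ofReal (excess T θ r c x) ∂(noiseLaw p E) ≤
      p * Fintype.card G * ENNReal.ofReal κ := by
  have h0 (j : Fin p) (g : G) (x : Fin p → E) :
      0 ≤ (misalignSet T θ r c j g).indicator (fun _ => gap T θ g) x :=
    Set.indicator_nonneg (fun _ _ => gap_nonneg _ _ _) _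
  have h1 (x : Fin p → E) : ENNReal.ofReal (excess T θ r c x) =
      ∑ j, ∑ g, (misalignSet T θ r c j g).indicator (fun _ => ENNReal.ofReal (gap T θ g)) x := by
    rw [excess, ENNReal.ofReal_sum_of_nonneg (fun j _ => Finset.sum_nonneg fun g _ => h0 j g x)]
    refine Finset.sum_congr rfl fun j _ => ?_
    rw [ENNReal.ofReal_sum_of_nonneg (fun g _ => h0 j g x)]
    refine Finset.sum_congr rfl fun g _ => ?_
    by_cases hx : x ∈ misalignSet T θ r c j g <;> simp [hx]
  have hm (j : Fin p) (g : G) : Measurable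
      ((misalignSet T θ r c j g).indicator fun _ => ENNReal.ofReal (gap T θ g)) :=
    measurable_const.indicator (measurableSet_misalignSet T θ r c j g)
  simp only [h1]
  rw [lintegral_finsetSum _ fun j _ => Finset.measurable_sum _ fun g _ => hm j g]
  calc _ = ∑ j, ∑ g, ENNReal.ofReal (gap T θ g) * noiseLaw p E (misalignSet T θ r c j g) := by
        refine Finset.sum_congr rfl fun j _ => ?_
        rw [lintegral_finsetSum _ fun g _ => hm j g]
        refine Finset.sum_congr rfl fun g _ => ?_
        rw [lintegral_indicator_const (measurableSet_misalignSet T θ r c j g)]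
    _ ≤ ∑ _j : Fin p, ∑ _g : G, ENNReal.ofReal κ :=
        Finset.sum_le_sum fun j _ => Finset.sum_le_sum fun g _ => h j g
    _ = _ := by simp [mul_assoc]

lemma measurable_excess [Fintype G] (θ : E) (r c : ℝ) :
    Measurable (excess (p := p) T θ r c) :=
  Finset.measurable_fun_sum _ fun j _ => Finset.measurable_fun_sum _ fun g _ =>
    measurable_const.indicator (measurableSet_misalignSet T θ r c j g)

lemma noiseLaw_excess_gt_le [Fintype G] {θ : E} {r c κ t : ℝ} (ht : 0 < t)
    (h : ∀ (j : Fin p) g, ENNReal.ofReal (gap T θ g) * noiseLaw p E (misalignSet T θ r c j g) ≤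
      ENNReal.ofReal κ) :
    noiseLaw p E {x | t < excess T θ r c x} ≤
      ENNReal.ofReal (p * Fintype.card G * κ / t) := by
  calc noiseLaw p E {x | t < excess T θ r c x}
      ≤ noiseLaw p E {x | ENNReal.ofReal t ≤ ENNReal.ofReal (excess T θ r c x)} :=
        measure_mono fun x hx => ENNReal.ofReal_le_ofReal (le_of_lt hx)
    _ ≤ (∫⁻ x, ENNReal.ofReal (excess T θ r c x) ∂(noiseLaw p E)) / ENNReal.ofReal t :=
        meas_ge_le_lintegral_div (measurable_excess T θ r c).ennreal_ofReal.aemeasurable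
          (by simpa using ht) ENNReal.ofReal_ne_top
    _ ≤ (p * Fintype.card G * ENNReal.ofReal κ) / ENNReal.ofReal t := by
        gcongr
        exact lintegral_excess_le T h
    _ = _ := by
        rw [ENNReal.ofReal_div_of_pos ht, ENNReal.ofReal_mul (by positivity),
          ENNReal.ofReal_mul (by positivity), ENNReal.ofReal_natCast, ENNReal.ofReal_natCast]

end Gaussian

/-! ### Choice of constants and the bound at a fixed exponent loss -/

section Nonasymptotic

variable {E G : Type*} [NormedAddCommGroup E] [InnerProductSpace ℝ E] [Group G] {p : ℕ}
  {T : G →* (E ≃ₗᵢ[ℝ] E)} {θ : E} {m ε : ℝ}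

/-- The noise configurations on which the iteration contracts, with the constants fixed in terms
of the loss `ε` in the exponent and the squared minimal gap `m`. -/
def goodNoise [Fintype G] (T : G →* (E ≃ₗᵢ[ℝ] E)) (θ : E) (m ε : ℝ) (p : ℕ) : Set (Fin p → E) :=
  {x | NoiseBound T (100 * (ε ^ 2 / 10 ^ 6) * p * m) x ∧
    excess T θ √(100 * (ε ^ 2 / 10 ^ 6) * m) (1 / 2 - 2 * (ε / 24)) x ≤
      p * Real.exp (-((1 - ε) * (m / 8)))}

theorem groupLoss_recursion [Fintype G] (hp : 1 ≤ p) (hm : 0 < m) (hε : 0 < ε) (hε1 : ε ≤ 1 / 2)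
    (hmε : 1 / 2 ≤ ε ^ 2 / 10 ^ 6 * m) {x : Fin p → E} (hx : x ∈ goodNoise T θ m ε p)
    (hgap : ∀ g, g ≠ 1 → m ≤ gap T θ g) (w : ℕ → Fin p → G)
    (h0 : groupLoss T θ (w 0) ≤ ε ^ 2 / 10 ^ 6 * (p * m))
    (hw : ∀ t j, ‖θ + x j - T (w (t + 1) j) (groupEstimate T θ x (w t))‖ ^ 2 ≤
      ‖θ + x j - groupEstimate T θ x (w t)‖ ^ 2) (t : ℕ) :
    groupLoss T θ (w (t + 1)) ≤
      p * Real.exp (-((1 - ε) * (m / 8))) + 1 / 2 * groupLoss T θ (w t) := by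
  set ρ := ε ^ 2 / 10 ^ 6 with hρ
  have hp' : (0 : ℝ) < p := by exact_mod_cast hp
  have hρ0 : 0 < ρ := by positivity
  have hε2 : ε ^ 2 ≤ 1 := by nlinarith
  have hρ1 : ρ ≤ 1 / 10 ^ 6 := by rw [hρ]; linarith
  have hρε : ε ^ 2 = 10 ^ 6 * ρ := by rw [hρ]; ring
  have hstep (s : ℕ) (hs : groupLoss T θ (w s) ≤ 4 * ρ * p * m) :
      groupLoss T θ (w (s + 1)) ≤
        p * Real.exp (-((1 - ε) * (m / 8))) + 1 / 2 * groupLoss T θ (w s) := by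
    have h := groupLoss_le_excess_add_half (l := 100 * ρ) (b := 4 * ρ) (q := ε / 24) hp
      (by positivity) (by positivity) hm (by positivity) (by nlinarith) (by nlinarith)
      (by nlinarith) hx.1 hgap (w s) (w (s + 1)) hs (hw s)
    have h2 : excess T θ √(100 * ρ * m) (1 / 2 - 2 * (ε / 24)) x ≤
        p * Real.exp (-((1 - ε) * (m / 8))) := hx.2
    linarith
  -- The region is invariant: the additive term is at most `p ≤ 2ρpm` because `ρm ≥ 1/2`, and half
  -- of `4ρpm` is the other `2ρpm`.
  have hinv (s : ℕ) : groupLoss T θ (w s) ≤ 4 * ρ * p * m := by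
    have hpm : 0 < ρ * (p * m) := by positivity
    induction s with
    | zero => linarith
    | succ s ih =>
      have h1 := hstep s ih
      have h2 : Real.exp (-((1 - ε) * (m / 8))) ≤ 1 := by
        apply Real.exp_le_one_iff.mpr
        have : 0 ≤ (1 - ε) * (m / 8) := mul_nonneg (by linarith) (by linarith)
        linarith
      have h3 := mul_le_mul_of_nonneg_left h2 hp'.le
      have h4 := mul_le_mul_of_nonneg_left hmε hp'.le
      nlinarith
  exact hstep t (hinv t)

variable [FiniteDimensional ℝ E] [MeasurableSpace E] [BorelSpace E]

/-- Of the allowed loss `ε` in the exponent, `ε/2` pays for the lowered threshold and the enlarged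
variance, and `ε/4` absorbs the prefactor `gap`. Only then is the gap replaced by its lower bound
`m`. -/
lemma gap_mul_noiseLaw_misalignSet_le (hε : 0 < ε) (hε1 : ε ≤ 1 / 2)
    (hm : 0 < m) (hgap : ∀ g, g ≠ 1 → m ≤ gap T θ g) (j : Fin p) (g : G) :
    ENNReal.ofReal (gap T θ g) * noiseLaw p E
      (misalignSet T θ √(100 * (ε ^ 2 / 10 ^ 6) * m) (1 / 2 - 2 * (ε / 24)) j g) ≤
    ENNReal.ofReal (32 / ε * Real.exp (-((1 - 3 / 4 * ε) * (m / 8)))) := by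
  rcases eq_or_ne g 1 with rfl | hg
  · rw [gap_one]
    simp
  have hgm := hgap g hg
  set y := gap T θ g with hy
  have hy0 : 0 < y := hm.trans_le hgm
  have hc : 0 ≤ 1 / 2 - 2 * (ε / 24) := by linarith
  have hr : √y + 2 * √(100 * (ε ^ 2 / 10 ^ 6) * m) ≤ (1 + ε / 24) * √y := by
    have h1 : √(100 * (ε ^ 2 / 10 ^ 6) * m) ≤ ε / 48 * √y := by
      rw [Real.sqrt_le_left (by positivity), mul_pow, Real.sq_sqrt hy0.le]
      calc 100 * (ε ^ 2 / 10 ^ 6) * m ≤ (ε / 48) ^ 2 * m := by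
            gcongr
            nlinarith [sq_nonneg ε]
        _ ≤ _ := by gcongr
    linarith
  have h := noiseLaw_misalignSet_le (p := p) T (θ := θ) (g := g) hc
    (s := (1 + ε / 24) * √y) (by positivity) hr j
  have hexp : (1 - 1 / 2 * ε) * (y / 8) ≤
      ((1 / 2 - 2 * (ε / 24)) * y) ^ 2 / (2 * ((1 + ε / 24) * √y) ^ 2) := by
    rw [mul_pow _ √y, Real.sq_sqrt hy0.le, le_div_iff₀ (by positivity)]
    have h1 : (1 - 1 / 2 * ε) * (1 + ε / 24) ^ 2 ≤ 4 * (1 / 2 - 2 * (ε / 24)) ^ 2 := by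
      nlinarith [pow_pos hε 2, pow_pos hε 3]
    have h2 := mul_le_mul_of_nonneg_right h1 (show 0 ≤ y ^ 2 / 4 by positivity)
    nlinarith
  calc _ ≤ ENNReal.ofReal y * ENNReal.ofReal (Real.exp (-((1 - 1 / 2 * ε) * (y / 8)))) := by
        gcongr
        exact h.trans (ENNReal.ofReal_le_ofReal (Real.exp_le_exp.mpr (by linarith)))
    _ = ENNReal.ofReal (y * Real.exp (-((1 - 1 / 2 * ε) * (y / 8)))) :=
        (ENNReal.ofReal_mul hy0.le).symm
    _ ≤ _ := by
        apply ENNReal.ofReal_le_ofReal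
        have h1 : ε / 32 * y ≤ Real.exp (ε / 32 * y) := by
          linarith [Real.add_one_le_exp (ε / 32 * y)]
        have h2 : y ≤ 32 / ε * Real.exp (ε / 32 * y) := by
          calc y = 32 / ε * (ε / 32 * y) := by field_simp
            _ ≤ _ := by gcongr
        calc y * Real.exp (-((1 - 1 / 2 * ε) * (y / 8)))
            ≤ 32 / ε * Real.exp (ε / 32 * y) * Real.exp (-((1 - 1 / 2 * ε) * (y / 8))) := by
              gcongr
          _ = 32 / ε * Real.exp (-((1 - 3 / 4 * ε) * (y / 8))) := by
              rw [mul_assoc, ← Real.exp_add]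
              congr 2
              ring
          _ ≤ _ := by
              gcongr
              linarith

lemma half_le_of_log_add_div_le {d : ℕ} {r : ℝ} (hd : 2 ≤ d)
    (h : Real.log d + (d : ℝ) / p ≤ r) : 1 / 2 ≤ r := by
  have h1 : Real.log 2 ≤ Real.log d := Real.log_le_log (by norm_num) (by exact_mod_cast hd)
  have h2 := Real.log_two_gt_d9
  have h3 : 0 ≤ (d : ℝ) / p := by positivity
  linarith

theorem noiseLaw_compl_goodNoise_le [Fintype G] (hp : 1 ≤ p) (hd : 2 ≤ Fintype.card G)
    (hE : Module.finrank ℝ E = Fintype.card G) (hm : 0 < m) (hε : 0 < ε) (hε1 : ε ≤ 1 / 2)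
    (hgap : ∀ g, g ≠ 1 → m ≤ gap T θ g)
    (hsnr : Real.log (Fintype.card G) + (Fintype.card G : ℝ) / p ≤ ε ^ 2 / 10 ^ 6 * m) :
    noiseLaw p E (goodNoise T θ m ε p)ᶜ ≤
      ENNReal.ofReal (Real.exp (-√m) + Real.exp (-(Fintype.card G : ℝ))) := by
  have hmε := half_le_of_log_add_div_le hd hsnr
  set d := Fintype.card G with hdG
  set ρ := ε ^ 2 / 10 ^ 6 with hρ
  have hp' : (0 : ℝ) < p := by exact_mod_cast hp
  have hd' : (0 : ℝ) < d := by exact_mod_cast (by omega : 0 < d)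
  have hlog : 1 / 2 ≤ Real.log d := by
    have h1 : Real.log 2 ≤ Real.log d := Real.log_le_log (by norm_num) (by exact_mod_cast hd)
    linarith [Real.log_two_gt_d9]
  have h1 : noiseLaw p E {x | ¬ NoiseBound T (100 * ρ * p * m) x} ≤
      ENNReal.ofReal (Real.exp (-(d : ℝ))) := by
    refine (noiseLaw_not_noiseBound_le T _).trans (ENNReal.ofReal_le_ofReal ?_)
    rw [hE, ← hdG]
    have e1 : (2 : ℝ) ^ d = Real.exp (d * Real.log 2) := by
      rw [Real.exp_nat_mul, Real.exp_log (by norm_num)]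
    have e2 : ((d : ℝ) * (6 / 5)) ^ p = Real.exp (p * (Real.log d + Real.log (6 / 5))) := by
      rw [Real.exp_nat_mul, Real.exp_add, Real.exp_log hd', Real.exp_log (by norm_num)]
    rw [e1, e2, ← Real.exp_add, ← Real.exp_add]
    apply Real.exp_le_exp.mpr
    have e3 : Real.log (6 / 5) ≤ 1 / 5 := by
      linarith [Real.log_le_sub_one_of_pos (show (0 : ℝ) < 6 / 5 by norm_num)]
    have e4 := Real.log_two_lt_d9
    have e5 : p * Real.log d + d ≤ ρ * p * m := by
      have := mul_le_mul_of_nonneg_left hsnr hp'.le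
      rw [mul_add, mul_div_cancel₀ _ hp'.ne'] at this
      linarith
    have e6 : p * (Real.log d + Real.log (6 / 5)) ≤ p * (2 * Real.log d) := by
      gcongr
      linarith
    have e7 : d * Real.log 2 ≤ d * 1 := by
      gcongr
      linarith
    have e8 : 0 ≤ p * Real.log d := mul_nonneg hp'.le (by linarith)
    linarith
  have h2 : noiseLaw p E {x | p * Real.exp (-((1 - ε) * (m / 8))) <
      excess T θ √(100 * ρ * m) (1 / 2 - 2 * (ε / 24)) x} ≤
      ENNReal.ofReal (Real.exp (-√m)) := by
    refine (noiseLaw_excess_gt_le T (by positivity)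
      (gap_mul_noiseLaw_misalignSet_le hε hε1 hm hgap)).trans (ENNReal.ofReal_le_ofReal ?_)
    rw [← hdG, div_le_iff₀ (by positivity)]
    -- The remaining `ε/4` of `m/8` is three times `ε/96 * m`: one share each for `log d`, `log
    -- (32/ε)` and the `√m` of the probability bound.
    have f1 : Real.log d ≤ ρ * m := by
      have : 0 ≤ (d : ℝ) / p := by positivity
      linarith
    have f2 : Real.log (32 / ε) ≤ 32 / ε := by
      linarith [Real.log_le_sub_one_of_pos (show 0 < 32 / ε by positivity)]
    have hbig : 500000 ≤ ε ^ 2 * m := by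
      rw [hρ] at hmε
      linarith
    have f3 : 32 / ε ≤ ε / 96 * m := by
      rw [div_le_iff₀ hε]
      nlinarith
    have f4 : ρ * m ≤ ε / 96 * m := by
      gcongr
      rw [hρ]
      nlinarith
    have f5 : √m ≤ ε / 96 * m := by
      rw [Real.sqrt_le_left (by positivity)]
      nlinarith
    have f6 : (d : ℝ) * (32 / ε) = Real.exp (Real.log d + Real.log (32 / ε)) := by
      rw [Real.exp_add, Real.exp_log hd', Real.exp_log (by positivity)]
    calc p * d * (32 / ε * Real.exp (-((1 - 3 / 4 * ε) * (m / 8))))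
        = p * ((d * (32 / ε)) * Real.exp (-((1 - 3 / 4 * ε) * (m / 8)))) := by ring
      _ = p * Real.exp (Real.log d + Real.log (32 / ε) + -((1 - 3 / 4 * ε) * (m / 8))) := by
          rw [f6, ← Real.exp_add]
      _ ≤ p * Real.exp (-√m + -((1 - ε) * (m / 8))) :=
          mul_le_mul_of_nonneg_left (Real.exp_le_exp.mpr (by linarith)) hp'.le
      _ = _ := by
          rw [Real.exp_add]
          ring
  have hsub : (goodNoise T θ m ε p)ᶜ ⊆
      {x | p * Real.exp (-((1 - ε) * (m / 8))) <
        excess T θ √(100 * ρ * m) (1 / 2 - 2 * (ε / 24)) x} ∪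
      {x | ¬ NoiseBound T (100 * ρ * p * m) x} := by
    intro x hx
    by_cases hn : NoiseBound T (100 * ρ * p * m) x
    · exact Or.inl (not_le.mp fun hle => hx ⟨hn, hle⟩)
    · exact Or.inr hn
  rw [ENNReal.ofReal_add (by positivity) (by positivity)]
  exact (measure_mono hsub).trans ((measure_union_le _ _).trans (add_le_add h2 h1))

end Nonasymptotic

/-! ### Cyclic shift matrices as a group of isometries -/

section Shift

variable {d : ℕ}

lemma minGapSq_nonneg (θ : EuclideanSpace ℝ (Fin d)) : 0 ≤ minGapSq θ :=
  Real.sInf_nonneg (by rintro _ ⟨U, _, rfl⟩; positivity)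

variable [NeZero d]

/-- The cyclic shifts as a group of linear isometries. -/
def shiftHom (d : ℕ) [NeZero d] :
    Multiplicative (Fin d) →* (EuclideanSpace ℝ (Fin d) ≃ₗᵢ[ℝ] EuclideanSpace ℝ (Fin d)) where
  -- Reindexing acts through the inverse permutation, so subtracting `g` from indices yields `v (i +
  -- g)`.
  toFun g := LinearIsometryEquiv.piLpCongrLeft 2 ℝ ℝ (Equiv.subRight g.toAdd)
  map_one' := by
    ext v i
    change v (i + 0) = v i
    rw [add_zero]
  map_mul' g h := by
    ext v i
    change v (i + (g.toAdd + h.toAdd)) = v (i + g.toAdd + h.toAdd)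
    rw [add_assoc]

lemma shiftHom_apply (g : Multiplicative (Fin d)) (v : EuclideanSpace ℝ (Fin d)) (i : Fin d) :
    shiftHom d g v i = v (i + g.toAdd) := rfl

lemma toEuclideanLin_cyclicShift (t : ℕ) (v : EuclideanSpace ℝ (Fin d)) :
    (cyclicShift d t).toEuclideanLin v =
      shiftHom d (Multiplicative.ofAdd (Fin.ofNat d t)) v := by
  ext i
  rw [shiftHom_apply, Matrix.ofLp_toLpLin, Matrix.toLin'_apply, Matrix.mulVec, dotProduct]
  have h (k : Fin d) : cyclicShift d t i k = if k = i + Fin.ofNat d t then 1 else 0 := by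
    simp [cyclicShift, Fin.ext_iff, Fin.val_add]
  simp [h]

lemma exists_shiftHom_eq {M : Matrix (Fin d) (Fin d) ℝ} (hM : M ∈ cyclicShifts d) :
    ∃ g, ∀ v, M.toEuclideanLin v = shiftHom d g v := by
  obtain ⟨t, rfl⟩ := hM
  exact ⟨_, toEuclideanLin_cyclicShift t⟩

lemma minGapSq_le_gap (θ : EuclideanSpace ℝ (Fin d)) (g : Multiplicative (Fin d)) (hg : g ≠ 1) :
    minGapSq θ ≤ gap (shiftHom d) θ g := by
  set k : Fin d := g.toAdd with hk
  have hk0 : k ≠ 0 := hg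
  -- The minimum runs over matrices other than the identity, so a nontrivial residue must be shown
  -- to give a nonidentity matrix; row `0` does.
  have hne : cyclicShift d k ≠ 1 := by
    intro h
    have h1 := congrFun (congrFun h 0) k
    rw [Matrix.one_apply_ne hk0.symm] at h1
    simp [cyclicShift, Nat.mod_eq_of_lt k.isLt] at h1
  have heq (v : EuclideanSpace ℝ (Fin d)) :
      (cyclicShift d k).toEuclideanLin v = shiftHom d g v := by
    rw [toEuclideanLin_cyclicShift]
    congr 2
    simp [hk]
  refine csInf_le ⟨0, by rintro _ ⟨U, _, rfl⟩; positivity⟩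
    ⟨cyclicShift d k, ⟨⟨k, rfl⟩, hne⟩, ?_⟩
  simp only [map_sub, LinearMap.sub_apply, heq]
  rw [gap, norm_sub_rev]
  simp

lemma transpose_toEuclideanLin {M : Matrix (Fin d) (Fin d) ℝ} {g : Multiplicative (Fin d)}
    (hM : ∀ v, M.toEuclideanLin v = shiftHom d g v) (y : EuclideanSpace ℝ (Fin d)) :
    Mᵀ.toEuclideanLin y = shiftHom d g⁻¹ y := by
  refine ext_inner_right ℝ fun v => ?_
  rw [inner_map_inv, ← hM, ← Matrix.conjTranspose_eq_transpose_of_trivial,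
    Matrix.toEuclideanLin_conjTranspose_eq_adjoint, LinearMap.adjoint_inner_left]

end Shift

/-! ### Transfer to the alignment model -/

/-- The conclusion of the recursion theorem for a single problem and exponent correction `δ`. -/
def RecursionBound (p d : ℕ) (θ : EuclideanSpace ℝ (Fin d)) (τ δ : ℝ) : Prop :=
  ∀ (Zstar : Fin p → Matrix (Fin d) (Fin d) ℝ), (∀ j, Zstar j ∈ cyclicShifts d) →
  ∀ (Ω : Type*) [MeasurableSpace Ω] (μ : Measure Ω) [IsProbabilityMeasure μ]
    (Y : Fin p → Ω → EuclideanSpace ℝ (Fin d)), IsModel μ θ Zstar Y →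
  ∀ (Z : ℕ → Ω → Fin p → Matrix (Fin d) (Fin d) ℝ), (∀ ω j, Z 0 ω j ∈ cyclicShifts d) →
    (∀ t ω, IsUpdate (fun j => Y j ω) (Z t ω) (Z (t + 1) ω)) →
  ∀ η : ℝ, 0 ≤ η → μ {ω | ¬ loss θ (Z 0 ω) Zstar ≤ τ} ≤ ENNReal.ofReal η →
    μ {ω | ¬ ∀ t : ℕ, 1 ≤ t → loss θ (Z t ω) Zstar ≤
        (p : ℝ) * Real.exp (-((1 + δ) * (minGapSq θ / 8))) +
          1 / 2 * loss θ (Z (t - 1) ω) Zstar} ≤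
      ENNReal.ofReal (η + Real.exp (-√(minGapSq θ)) + Real.exp (-(d : ℝ)))

section Recursion

variable {p d : ℕ} {θ : EuclideanSpace ℝ (Fin d)} {τ : ℝ}

universe u

lemma RecursionBound.mono {δ δ' : ℝ} (h : RecursionBound.{u} p d θ τ δ) (hδ : δ' ≤ δ) :
    RecursionBound.{u} p d θ τ δ' := by
  intro Zs hZs Ω _ μ _ Y hY Z hZ0 hZ η hη hinit
  refine le_trans (measure_mono ?_) (h Zs hZs Ω μ Y hY Z hZ0 hZ η hη hinit)
  intro ω hω hall
  refine hω fun t ht => (hall t ht).trans ?_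
  have := minGapSq_nonneg θ
  gcongr

lemma mem_cyclicShifts_of_isUpdate {Ω : Type*} {Y : Fin p → Ω → EuclideanSpace ℝ (Fin d)}
    {Z : ℕ → Ω → Fin p → Matrix (Fin d) (Fin d) ℝ} (hZ0 : ∀ ω j, Z 0 ω j ∈ cyclicShifts d)
    (hZ : ∀ t ω, IsUpdate (fun j => Y j ω) (Z t ω) (Z (t + 1) ω)) (t : ℕ) (ω : Ω) (j : Fin p) :
    Z t ω j ∈ cyclicShifts d := by
  cases t with
  | zero => exact hZ0 ω j
  | succ t => exact (hZ t ω j).1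

lemma loss_le [NeZero d] {Z Zstar : Fin p → Matrix (Fin d) (Fin d) ℝ}
    (hZ : ∀ j, Z j ∈ cyclicShifts d) (hZs : ∀ j, Zstar j ∈ cyclicShifts d) :
    loss θ Z Zstar ≤ p * (4 * ‖θ‖ ^ 2) := by
  calc loss θ Z Zstar ≤ ∑ _j : Fin p, 4 * ‖θ‖ ^ 2 := by
        refine Finset.sum_le_sum fun j _ => ?_
        obtain ⟨g, hg⟩ := exists_shiftHom_eq (hZ j)
        obtain ⟨h, hh⟩ := exists_shiftHom_eq (hZs j)
        rw [map_sub, LinearMap.sub_apply, hg, hh]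
        have := norm_sub_le (shiftHom d g θ) (shiftHom d h θ)
        rw [LinearIsometryEquiv.norm_map, LinearIsometryEquiv.norm_map] at this
        nlinarith [norm_nonneg (shiftHom d g θ - shiftHom d h θ)]
    _ = _ := by simp

/-- Covers the indices before the asymptotic regime. If the minimal gap is zero, the allowed failure
probability is at least `1`; otherwise a large `ε` makes the additive term `p * exp (4‖θ‖²)`, which
exceeds any possible loss. -/
lemma exists_recursionBound (hd : 2 ≤ d) (θ : EuclideanSpace ℝ (Fin d)) (τ : ℝ) :
    ∃ ε, RecursionBound.{u} p d θ τ (-ε) := by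
  have : NeZero d := ⟨by omega⟩
  rcases (minGapSq_nonneg θ).eq_or_lt with h0 | hm
  · refine ⟨0, fun Zs hZs Ω _ μ _ Y hY Z hZ0 hZ η hη hinit => ?_⟩
    refine prob_le_one.trans ?_
    rw [← ENNReal.ofReal_one]
    apply ENNReal.ofReal_le_ofReal
    rw [← h0, Real.sqrt_zero, neg_zero, Real.exp_zero]
    linarith [Real.exp_pos (-(d : ℝ))]
  · refine ⟨1 + 4 * ‖θ‖ ^ 2 * (8 / minGapSq θ), fun Zs hZs Ω _ μ _ Y hY Z hZ0 hZ η hη hinit => ?_⟩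
    have hempty : {ω | ¬ ∀ t : ℕ, 1 ≤ t → loss θ (Z t ω) Zs ≤
        (p : ℝ) * Real.exp (-((1 + -(1 + 4 * ‖θ‖ ^ 2 * (8 / minGapSq θ))) * (minGapSq θ / 8))) +
          1 / 2 * loss θ (Z (t - 1) ω) Zs} = ∅ := by
      refine Set.eq_empty_of_forall_notMem fun ω hω => hω fun t _ => ?_
      have h1 := loss_le (θ := θ) (mem_cyclicShifts_of_isUpdate hZ0 hZ t ω) hZs
      have h2 : -((1 + -(1 + 4 * ‖θ‖ ^ 2 * (8 / minGapSq θ))) * (minGapSq θ / 8)) =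
          4 * ‖θ‖ ^ 2 := by field_simp; ring
      have h3 : 0 ≤ loss θ (Z (t - 1) ω) Zs := Finset.sum_nonneg fun _ _ => sq_nonneg _
      have h4 : 4 * ‖θ‖ ^ 2 ≤ Real.exp (4 * ‖θ‖ ^ 2) := by
        linarith [Real.add_one_le_exp (4 * ‖θ‖ ^ 2)]
      rw [h2]
      have h5 := mul_le_mul_of_nonneg_left h4 (Nat.cast_nonneg (α := ℝ) p)
      linarith
    rw [hempty, measure_empty]
    exact zero_le

lemma hasLaw_shiftHom_inv_sub [NeZero d] {Ω : Type*} [MeasurableSpace Ω] {μ : Measure Ω}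
    {y : Ω → EuclideanSpace ℝ (Fin d)} {g : Multiplicative (Fin d)}
    (hy : HasLaw y (multivariateGaussian (shiftHom d g θ) 1) μ) :
    HasLaw (fun ω => shiftHom d g⁻¹ (y ω) - θ) (stdGaussian (EuclideanSpace ℝ (Fin d))) μ := by
  refine HasLaw.fun_comp (Y := fun v => shiftHom d g⁻¹ v - θ) ⟨by fun_prop, ?_⟩ hy
  rw [multivariateGaussian, Measure.map_map (by fun_prop) (by fun_prop)]
  refine Eq.trans ?_ (stdGaussian_map (shiftHom d g⁻¹))
  congr 1
  ext1 v
  simp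

/-- A data set drawn from the model, seen in the frames of the true shifts, is `θ` plus independent
standard Gaussian noise. -/
lemma map_noise_eq_noiseLaw [NeZero d] {Ω : Type*} [MeasurableSpace Ω] {μ : Measure Ω}
    [IsProbabilityMeasure μ] {Zstar : Fin p → Matrix (Fin d) (Fin d) ℝ}
    {Y : Fin p → Ω → EuclideanSpace ℝ (Fin d)} (hY : IsModel μ θ Zstar Y)
    {s : Fin p → Multiplicative (Fin d)}
    (hs : ∀ j v, (Zstar j).toEuclideanLin v = shiftHom d (s j) v) :
    AEMeasurable (fun ω j => shiftHom d (s j)⁻¹ (Y j ω) - θ) μ ∧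
    μ.map (fun ω j => shiftHom d (s j)⁻¹ (Y j ω) - θ) =
      noiseLaw p (EuclideanSpace ℝ (Fin d)) := by
  have hlaw (j : Fin p) := hasLaw_shiftHom_inv_sub (θ := θ) (g := s j)
    (by rw [← hs]; exact hY.law j)
  have hind := hY.indep.comp (fun j v => shiftHom d (s j)⁻¹ v - θ) (fun j => by fun_prop)
  refine ⟨aemeasurable_pi_lambda _ fun j => (hlaw j).aemeasurable, ?_⟩
  have h := iIndepFun.map_fun_eq_pi_map (fun j => (hlaw j).aemeasurable) hind
  refine h.trans ?_
  congr 1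
  ext1 j
  exact (hlaw j).map_eq

theorem recursionBound {ε : ℝ} (hp : 1 ≤ p) (hd : 2 ≤ d) (hm : 0 < minGapSq θ) (hε : 0 < ε)
    (hε1 : ε ≤ 1 / 2) (hsnr : Real.log d + (d : ℝ) / p ≤ ε ^ 2 / 10 ^ 6 * minGapSq θ)
    (hτ : τ ≤ ε ^ 2 / 10 ^ 6 * (p * minGapSq θ)) : RecursionBound.{u} p d θ τ (-ε) := by
  have : NeZero d := ⟨by omega⟩
  intro Zs hZs Ω _ μ _ Y hY Z hZ0 hZ η hη hinit
  have hgap := minGapSq_le_gap θ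
  set m := minGapSq θ with hmdef
  set T := shiftHom d with hT
  have hcard : Fintype.card (Multiplicative (Fin d)) = d := by simp
  choose s hs using fun j => exists_shiftHom_eq (hZs j)
  choose z hz using fun t ω j => exists_shiftHom_eq (mem_cyclicShifts_of_isUpdate hZ0 hZ t ω j)
  set ξ : Ω → Fin p → EuclideanSpace ℝ (Fin d) := fun ω j => T (s j)⁻¹ (Y j ω) - θ with hξ
  obtain ⟨hξm, hξlaw⟩ := map_noise_eq_noiseLaw hY hs
  set w : ℕ → Ω → Fin p → Multiplicative (Fin d) := fun t ω j => (s j)⁻¹ * z t ω j with hw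
  have hloss (t : ℕ) (ω : Ω) : loss θ (Z t ω) Zs = groupLoss T θ (w t ω) := by
    refine Finset.sum_congr rfl fun j _ => ?_
    rw [map_sub, LinearMap.sub_apply, hz, hs, gap, ← (T (s j)⁻¹).norm_map, map_sub, map_inv_map,
      hw, map_mul]
    rfl
  have hθξ (ω : Ω) (j : Fin p) : θ + ξ ω j = T (s j)⁻¹ (Y j ω) := by simp [hξ]
  have hest (t : ℕ) (ω : Ω) : thetaHat (fun j => Y j ω) (Z t ω) =
      groupEstimate T θ (ξ ω) (w t ω) := by
    rw [thetaHat, groupEstimate]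
    congr 1
    refine Finset.sum_congr rfl fun j _ => ?_
    rw [transpose_toEuclideanLin (hz t ω j), hθξ, hw, mul_inv_rev, inv_inv, map_mul]
    change _ = T (z t ω j)⁻¹ (T (s j) (T (s j)⁻¹ (Y j ω)))
    rw [map_map_inv]
  have hupd (t : ℕ) (ω : Ω) (j : Fin p) :
      ‖θ + ξ ω j - T (w (t + 1) ω j) (groupEstimate T θ (ξ ω) (w t ω))‖ ^ 2 ≤
        ‖θ + ξ ω j - groupEstimate T θ (ξ ω) (w t ω)‖ ^ 2 := by
    -- Of the minimizing property only the comparison with the true shift matters, so ties are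
    -- harmless.
    have h := (hZ t ω j).2 (Zs j) (hZs j)
    rw [hest, hz, hs, ← (T (s j)⁻¹).norm_map, ← (T (s j)⁻¹).norm_map (Y j ω - T (s j) _),
      map_sub, map_sub, map_inv_map] at h
    rw [hθξ, hw, map_mul]
    exact h
  have hmε := half_le_of_log_add_div_le hd hsnr
  have hsub : {ω | ¬ ∀ t : ℕ, 1 ≤ t → loss θ (Z t ω) Zs ≤
        (p : ℝ) * Real.exp (-((1 + -ε) * (m / 8))) + 1 / 2 * loss θ (Z (t - 1) ω) Zs} ⊆
      {ω | ¬ loss θ (Z 0 ω) Zs ≤ τ} ∪ ξ ⁻¹' (goodNoise T θ m ε p)ᶜ := by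
    intro ω hω
    by_contra hcon
    simp only [Set.mem_union, Set.mem_ofPred_eq, not_or, not_not, Set.mem_preimage,
      Set.mem_compl_iff] at hcon
    refine hω fun t ht => ?_
    obtain ⟨t, rfl⟩ := Nat.exists_eq_add_of_le' ht
    have h := groupLoss_recursion hp hm hε hε1 hmε hcon.2 hgap (fun t => w t ω)
      (by rw [← hloss]; exact hcon.1.trans hτ) (fun t j => hupd t ω j) t
    rw [Nat.add_sub_cancel, hloss, hloss, ← sub_eq_add_neg]
    exact h
  have hbad : μ (ξ ⁻¹' (goodNoise T θ m ε p)ᶜ) ≤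
      ENNReal.ofReal (Real.exp (-√m) + Real.exp (-(d : ℝ))) := by
    -- This inequality holds for arbitrary sets, so measurability of `goodNoise` need not be
    -- checked.
    refine (Measure.le_map_apply hξm _).trans ?_
    rw [hξlaw]
    have h := noiseLaw_compl_goodNoise_le (T := T) (θ := θ) hp (by rwa [hcard])
      (by rw [hcard]; simp) hm hε hε1 hgap (by rwa [hcard])
    rwa [hcard] at h
  rw [add_assoc, ENNReal.ofReal_add hη (by positivity)]
  exact (measure_mono hsub).trans ((measure_union_le _ _).trans (add_le_add hinit hbad))

end Recursion

/-! ### Letting the exponent loss tend to zero -/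

/-- An upward closed property that holds eventually for every positive threshold and for some
threshold at every index holds along a sequence of thresholds tending to zero. -/
lemma exists_tendsto_zero_of_eventually {P : ℕ → ℝ → Prop}
    (hmono : ∀ n a b, P n a → a ≤ b → P n b) (hex : ∀ n, ∃ a, P n a)
    (hev : ∀ a, 0 < a → ∀ᶠ n in atTop, P n a) :
    ∃ e : ℕ → ℝ, Tendsto e atTop (𝓝 0) ∧ ∀ n, P n (e n) := by
  set S : ℕ → Set ℝ := fun n => {a | 0 < a ∧ P n a} with hS
  have hne (n : ℕ) : (S n).Nonempty := by
    obtain ⟨a, ha⟩ := hex n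
    exact ⟨max a 1, lt_max_of_lt_right one_pos, hmono n a _ ha (le_max_left _ _)⟩
  have hbdd (n : ℕ) : BddBelow (S n) := ⟨0, fun a ha => ha.1.le⟩
  have hlim : Tendsto (fun n => sInf (S n)) atTop (𝓝 0) := by
    rw [Metric.tendsto_atTop']
    intro a ha
    obtain ⟨N, hN⟩ := eventually_atTop.mp (hev (a / 2) (by positivity))
    refine ⟨N, fun n hn => ?_⟩
    have h1 : sInf (S n) ≤ a / 2 := csInf_le (hbdd n) ⟨by positivity, hN n hn.le⟩
    have h2 : 0 ≤ sInf (S n) := Real.sInf_nonneg fun a ha => ha.1.le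
    rw [Real.dist_eq, sub_zero, abs_of_nonneg h2]
    linarith
  -- The infimum need not be attained; the vanishing margin puts an admissible threshold strictly
  -- below the chosen one.
  refine ⟨fun n => sInf (S n) + 1 / ((n : ℝ) + 1), ?_, fun n => ?_⟩
  · simpa using hlim.add tendsto_one_div_add_atTop_nhds_zero_nat
  · obtain ⟨a, ha, hlt⟩ := (csInf_lt_iff (hbdd n) (hne n)).mp
      (lt_add_of_pos_right (sInf (S n)) (show 0 < 1 / ((n : ℝ) + 1) by positivity))
    exact hmono n a _ ha.2 hlt.le

end

end MRA

theorem theorem7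
    (p d : ℕ → ℕ) (hp : ∀ n, 1 ≤ p n) (hd : ∀ n, 2 ≤ d n)
    (θ : ∀ n, EuclideanSpace ℝ (Fin (d n))) (τ : ℕ → ℝ)
    -- `Δ_min² / (log d + d / p) → ∞`
    (hSNR : Tendsto
      (fun n => MRA.minGapSq (θ n) / (Real.log (d n) + (d n : ℝ) / (p n : ℝ))) atTop atTop)
    -- the initialization level is `o(p Δ_min²)`
    (hτ : τ =o[atTop] fun n => (p n : ℝ) * MRA.minGapSq (θ n)) :
    -- the sequence `δ` is the `o(1)` in the exponent
    ∃ δ : ℕ → ℝ, Tendsto δ atTop (𝓝 0) ∧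
      ∀ (n : ℕ) (Zstar : Fin (p n) → Matrix (Fin (d n)) (Fin (d n)) ℝ),
        (∀ j, Zstar j ∈ MRA.cyclicShifts (d n)) →
      ∀ (Ω : Type*) [MeasurableSpace Ω] (μ : Measure Ω) [IsProbabilityMeasure μ]
        (Y : Fin (p n) → Ω → EuclideanSpace ℝ (Fin (d n))),
        MRA.IsModel μ (θ n) Zstar Y →
      ∀ (Z : ℕ → Ω → Fin (p n) → Matrix (Fin (d n)) (Fin (d n)) ℝ),
        (∀ ω j, Z 0 ω j ∈ MRA.cyclicShifts (d n)) →
        (∀ t ω, MRA.IsUpdate (fun j => Y j ω) (Z t ω) (Z (t + 1) ω)) →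
      ∀ η : ℝ, 0 ≤ η →
        -- `ℓ(Z⁽⁰⁾, Z*) ≤ τ` with probability at least `1 - η`
        μ {ω | ¬ MRA.loss (θ n) (Z 0 ω) Zstar ≤ τ n} ≤ ENNReal.ofReal η →
        -- the recursion with probability at least `1 - η - exp(-Δ_min) - exp(-d)`
        μ {ω | ¬ ∀ t : ℕ, 1 ≤ t →
            MRA.loss (θ n) (Z t ω) Zstar ≤
              (p n : ℝ) * Real.exp (-((1 + δ n) * (MRA.minGapSq (θ n) / 8))) +
                1 / 2 * MRA.loss (θ n) (Z (t - 1) ω) Zstar} ≤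
          ENNReal.ofReal
            (η + Real.exp (-√(MRA.minGapSq (θ n))) + Real.exp (-(d n : ℝ))) := by
  obtain ⟨e, he, hP⟩ := MRA.exists_tendsto_zero_of_eventually
    (P := fun n ε => MRA.RecursionBound (p n) (d n) (θ n) (τ n) (-ε))
    (fun n a b h hab => h.mono (neg_le_neg hab))
    (fun n => MRA.exists_recursionBound (hd n) (θ n) (τ n)) (fun a ha => by
      -- The cap meets the restriction `ε ≤ 1/2` of `recursionBound`; monotonicity recovers the
      -- bound for `a`.
      set ε := min a (1 / 2) with hεdef
      have hε : 0 < ε := lt_min ha (by norm_num)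
      have hc : 0 < ε ^ 2 / 10 ^ 6 := by positivity
      filter_upwards [hSNR.eventually_ge_atTop (ε ^ 2 / 10 ^ 6)⁻¹, hτ.bound hc] with n hn hτn
      have hden : 0 < Real.log (d n) + (d n : ℝ) / (p n : ℝ) := by
        have h1 : 0 < Real.log (d n) := Real.log_pos (by exact_mod_cast hd n)
        positivity
      rw [le_div_iff₀ hden, inv_mul_le_iff₀ hc] at hn
      have hm : 0 < MRA.minGapSq (θ n) := pos_of_mul_pos_right (hden.trans_le hn) hc.le
      refine (MRA.recursionBound (hp n) (hd n) hm hε (min_le_right _ _) hn ?_).mono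
        (neg_le_neg (min_le_left _ _))
      rw [Real.norm_of_nonneg (by positivity : 0 ≤ (p n : ℝ) * MRA.minGapSq (θ n))] at hτn
      exact (Real.le_norm_self _).trans hτn)
  refine ⟨fun n => -e n, by simpa using he.neg, fun n => hP n⟩
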